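/- Let $D_1$ be the open unit disc of $\mathbb R^2$ and, for $\kappa>0$, consider the eigenvalue problem (in $\lambda\in\mathbb R$) $$\Delta^2u-\kappa^2u=-\lambda\,\Delta u\ \text{ in }D_1,\qquad u=\partial_r u=0\ \text{ on }\partial D_1 ,$$ where an eigenfunction is a function $u\in C^4(D_1)\cap C^1(\overline{D_1})$, $u\not\equiv0$, real- or complex-valued, that satisfies these equations. Let $J_k$ and $I_k$ be the Bessel function and the modified Bessel function of the first kind of order $k$, let $j_{1,1}$ be the smallest positive zero of $J_1$, and let $\alpha_{0,1}=\alpha_{0,1}(\kappa)$ be the smallest positive zero of $$F_0(\alpha)=\frac{\kappa}{\alpha}J_0(\alpha)\,I_0'\!\Big(\frac{\kappa}{\alpha}\Big)-\alpha\, I_0\!\Big(\frac{\kappa}{\alpha}\Big)J_0'(\alpha)$$ (these smallest zeros exist). Then, for every $\kappa>0$, the problem has a smallest eigenvalue $\lambda_1=\lambda_1(\kappa)$; it is simple (its eigenspace is one-dimensional) and $$\lambda_1=\alpha_{0,1}^2-\frac{\kappa^2}{\alpha_{0,1}^2}.$$ Its eigenfunctions are exactly the radial functions $$u(x)=c\,J_0(\alpha_{0,1}|x|)+d\,I_0\!\Big(\frac{\kappa}{\alpha_{0,1}}|x|\Big)$$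 with $(c,d)\neq(0,0)$ a solution (real or complex, according to the values of $u$) of $$c\,J_0(\alpha_{0,1})+d\,I_0\!\Big(\frac{\kappa}{\alpha_{0,1}}\Big)=0,\qquad c\,\alpha_{0,1}J_0'(\alpha_{0,1})+d\,\frac{\kappa}{\alpha_{0,1}}I_0'\!\Big(\frac{\kappa}{\alpha_{0,1}}\Big)=0 .$$ Moreover $\lambda_1$ is a strictly decreasing function of $\kappa\in(0,\infty)$, and $$\lim_{\kappa\to0^+}\lambda_1(\kappa)=j_{1,1}^2,\qquad \lim_{\kappa\to\infty}\lambda_1(\kappa)=-\infty .$$ -/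

import Mathlib

open scoped Laplacian
open Filter Topology Metric

noncomputable section

/-- The Bessel function of the first kind `J_k` of order `k ∈ ℕ` on the real line. -/
def besselJ (k : ℕ) (x : ℝ) : ℝ :=
  ∑' m : ℕ, (-1 : ℝ) ^ m / ((m.factorial : ℝ) * ((m + k).factorial : ℝ)) * (x / 2) ^ (2 * m + k)

/-- The modified Bessel function of the first kind `I_k` of order `k ∈ ℕ` on the real line. -/
def besselI (k : ℕ) (x : ℝ) : ℝ :=
  ∑' m : ℕ, 1 / ((m.factorial : ℝ) * ((m + k).factorial : ℝ)) * (x / 2) ^ (2 * m + k)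

/-- The set of positive zeros of a real function. -/
def positiveZeros (f : ℝ → ℝ) : Set ℝ :=
  {x | 0 < x ∧ f x = 0}

/-- The first positive zero of `f` (meaningful when `positiveZeros f` has a least element). -/
def firstPositiveZero (f : ℝ → ℝ) : ℝ :=
  sInf (positiveZeros f)

/-- `F_k(α) = (κ/α) J_k(α) I_k'(κ/α) - α I_k(κ/α) J_k'(α)`. -/
def bucklingDet (k : ℕ) (κ α : ℝ) : ℝ :=
  κ / α * besselJ k α * deriv (besselI k) (κ / α) - α * besselI k (κ / α) * deriv (besselJ k) α

/-- `α_{0,1}(κ)`, the first positive root of `F_0`. -/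
def alphaZeroOne (κ : ℝ) : ℝ :=
  firstPositiveZero (bucklingDet 0 κ)

/-- `j_{1,1}`, the first positive zero of `J_1`. -/
def jOneOne : ℝ :=
  firstPositiveZero (besselJ 1)

/-- The Euclidean plane. -/
abbrev Plane : Type := EuclideanSpace ℝ (Fin 2)

/-- `u` is a (classical) eigenfunction for the eigenvalue `lam` of
`Δ² u - κ² u = -lam Δ u` in the unit disc, `u = ∂_r u = 0` on the unit circle.
Only the values of `u` on the closed disc matter. -/
structure IsBucklingEigenfunction {𝕜 : Type*} [RCLike 𝕜] (κ lam : ℝ) (u : Plane → 𝕜) : Prop where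
  contDiffOn_ball : ContDiffOn ℝ 4 u (ball 0 1)
  contDiffOn_closedBall : ContDiffOn ℝ 1 u (closedBall 0 1)
  equation : ∀ x ∈ ball (0 : Plane) 1, Δ (Δ u) x - (κ ^ 2) • u x = -(lam • Δ u x)
  boundary_value : ∀ x ∈ sphere (0 : Plane) 1, u x = 0
  /-- The outward radial derivative; on the unit circle the radial unit vector at `x` is `x`. -/
  boundary_deriv : ∀ x ∈ sphere (0 : Plane) 1, fderivWithin ℝ u (closedBall 0 1) x x = 0
  nontrivial : ∃ x ∈ ball (0 : Plane) 1, u x ≠ 0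

/-- The real eigenvalues of the problem, with eigenfunctions having values in `𝕜` (`ℝ` or `ℂ`). -/
def bucklingEigenvalues (𝕜 : Type*) [RCLike 𝕜] (κ : ℝ) : Set ℝ :=
  {lam | ∃ u : Plane → 𝕜, IsBucklingEigenfunction κ lam u}

/-- The first (smallest) eigenvalue `λ₁(κ)`. -/
def firstBucklingEigenvalue (𝕜 : Type*) [RCLike 𝕜] (κ : ℝ) : ℝ :=
  sInf (bucklingEigenvalues 𝕜 κ)

/-- The eigenspace of `lam`, as a space of functions on the closed disc, is one-dimensional. -/
def IsSimpleBucklingEigenvalue (𝕜 : Type*) [RCLike 𝕜] (κ lam : ℝ) : Prop :=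
  ∃ φ : Plane → 𝕜, IsBucklingEigenfunction κ lam φ ∧
    ∀ u : Plane → 𝕜, IsBucklingEigenfunction κ lam u →
      ∃ z : 𝕜, ∀ x ∈ closedBall (0 : Plane) 1, u x = z * φ x

/-- `(c, d)` is a nontrivial solution of the linear system
`c J_0(α) + d I_0(κ/α) = 0`, `c α J_0'(α) + d (κ/α) I_0'(κ/α) = 0`. -/
def IsBoundaryCoeff {𝕜 : Type*} [RCLike 𝕜] (κ α : ℝ) (c d : 𝕜) : Prop :=
  (c, d) ≠ 0 ∧
  c * ((besselJ 0 α : ℝ) : 𝕜) + d * ((besselI 0 (κ / α) : ℝ) : 𝕜) = 0 ∧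
  c * ((α * deriv (besselJ 0) α : ℝ) : 𝕜)
    + d * ((κ / α * deriv (besselI 0) (κ / α) : ℝ) : 𝕜) = 0

end

/-! Every real `lam` equals `α² - β²` with `αβ = κ` for some `α > 0`, and then the equation factors
as `(Δ + α²)(Δ - β²)u = 0`. Both `(Δ - β²)u` and `(Δ + α²)u` solve Helmholtz equations and their
difference is a multiple of `u`, so each angular Fourier mode of `u` is a combination of `J_k(αr)`
and `I_k(βr)`, subject to two linear boundary conditions at `r = 1`. Since `α² - κ²/α²` increases
with `α`, it suffices to find the smallest admissible `α`.

For `k ≥ 1` and `α < j_{1,1}`, both `J_k` and `J_{k+1}` are positive at `α`, which makes the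
determinant of the boundary system positive: the mode vanishes
(`IsClampedSolution.angularComponent_eq_zero`). For `k = 0` the determinant is `F_0(α)`. As
`F_0(j_{1,1}) < 0`, its first zero lies below `j_{1,1}`. Hence nothing occurs below `α_{0,1}`, and
at `α_{0,1}` only the radial mode survives. No variational principle or spectral theorem is needed.

For the dependence on `κ`, write `F_0(α) = 0` as `q(κ/α) J_0(α) = -α J_1(α)` with `q(x) = x
I_1(x)/I_0(x)`, which is increasing (`strictMonoOn_besselI_quotient`). Since `J_0(α_{0,1}) < 0`,
raising `κ` makes `F_0` negative at the old root, so `α_{0,1}` strictly decreases and `λ₁` with it.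
As `κ → 0`, `q` tends to `0` and forces `J_1(α_{0,1}) → 0`; as `κ → ∞`, the bound `α_{0,1} <
j_{1,1}` suffices. -/

/-! ### The power series behind the Bessel functions -/

/-- The entire function `∑ sᵐ / (m! (m + k)!)`, through which all Bessel functions of integer order
are expressed. -/
noncomputable def besselSeries (k : ℕ) (s : ℝ) : ℝ :=
  ∑' m : ℕ, s ^ m / ((m.factorial : ℝ) * ((m + k).factorial : ℝ))

theorem norm_besselSeries_term_le (k m : ℕ) (s : ℝ) :
    ‖s ^ m / ((m.factorial : ℝ) * ((m + k).factorial : ℝ))‖ ≤ |s| ^ m / m.factorial := by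
  have h1 : (1 : ℝ) ≤ (m + k).factorial := by exact_mod_cast (m + k).factorial_pos
  have h2 : (0 : ℝ) < m.factorial := by exact_mod_cast m.factorial_pos
  rw [norm_div, norm_pow, Real.norm_eq_abs, Real.norm_of_nonneg (by positivity)]
  gcongr
  nlinarith

theorem summable_besselSeries (k : ℕ) (s : ℝ) :
    Summable fun m : ℕ => s ^ m / ((m.factorial : ℝ) * ((m + k).factorial : ℝ)) :=
  Summable.of_norm_bounded (Real.summable_pow_div_factorial |s|)
    fun m => norm_besselSeries_term_le k m s

theorem besselSeries_deriv_term (k m : ℕ) (s : ℝ) :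
    ((m + 1 : ℕ) : ℝ) * s ^ m / (((m + 1).factorial : ℝ) * ((m + 1 + k).factorial : ℝ)) =
      s ^ m / ((m.factorial : ℝ) * ((m + (k + 1)).factorial : ℝ)) := by
  rw [show m + 1 + k = m + (k + 1) by ring, Nat.factorial_succ m]
  have h1 : (m.factorial : ℝ) ≠ 0 := by positivity
  have h2 : ((m + (k + 1)).factorial : ℝ) ≠ 0 := by positivity
  have h3 : ((m + 1 : ℕ) : ℝ) ≠ 0 := by positivity
  push_cast at *
  field_simp

theorem hasDerivAt_besselSeries (k : ℕ) (s : ℝ) :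
    HasDerivAt (besselSeries k) (besselSeries (k + 1) s) s := by
  set R : ℝ := |s| + 1
  have hR : 0 ≤ R := by positivity
  have hsR : s ∈ Metric.ball (0 : ℝ) R := by
    simp only [Metric.mem_ball, dist_zero_right, Real.norm_eq_abs, R]
    linarith
  have key := hasDerivAt_tsum_of_isPreconnected (𝕜 := ℝ) (F := ℝ)
    (g := fun (m : ℕ) (y : ℝ) => y ^ m / ((m.factorial : ℝ) * ((m + k).factorial : ℝ)))
    (g' := fun (m : ℕ) (y : ℝ) =>
      (m : ℝ) * y ^ (m - 1) / ((m.factorial : ℝ) * ((m + k).factorial : ℝ)))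
    (u := fun m : ℕ => (m : ℝ) * R ^ (m - 1) / ((m.factorial : ℝ) * ((m + k).factorial : ℝ)))
    (t := Metric.ball 0 R) (y₀ := s) (y := s) ?_ Metric.isOpen_ball
    (convex_ball _ _).isPreconnected ?_ ?_ hsR (summable_besselSeries k s) hsR
  · refine key.congr_deriv ?_
    -- The truncated exponent `m - 1` is harmless: the term `m = 0` carries the factor `0` and is
    -- split off.
    rw [Summable.tsum_eq_zero_add]
    · simp only [CharP.cast_eq_zero, zero_mul, zero_div, zero_add, Nat.add_sub_cancel]
      simp_rw [besselSeries_deriv_term]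
      rfl
    · rw [← summable_nat_add_iff 1]
      simp only [Nat.add_sub_cancel, besselSeries_deriv_term]
      exact summable_besselSeries (k + 1) s
  · rw [← summable_nat_add_iff 1]
    simp only [Nat.add_sub_cancel, besselSeries_deriv_term]
    exact summable_besselSeries (k + 1) R
  · intro m y _
    exact (hasDerivAt_pow m y).div_const _
  · intro m y hy
    have hy' : |y| ≤ R := by
      rw [Metric.mem_ball, dist_zero_right, Real.norm_eq_abs] at hy
      exact hy.le
    rw [norm_div, norm_mul, norm_pow, Real.norm_eq_abs y, Real.norm_of_nonneg (by positivity),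
      Real.norm_of_nonneg (by positivity)]
    gcongr

theorem differentiable_besselSeries (k : ℕ) : Differentiable ℝ (besselSeries k) :=
  fun s => (hasDerivAt_besselSeries k s).differentiableAt

theorem continuous_besselSeries (k : ℕ) : Continuous (besselSeries k) :=
  (differentiable_besselSeries k).continuous

theorem contDiff_besselSeries (n : ℕ) : ∀ k, ContDiff ℝ n (besselSeries k) := by
  induction n with
  | zero => exact fun k => contDiff_zero.2 (continuous_besselSeries k)
  | succ n ih =>
    intro k
    push_cast
    rw [contDiff_succ_iff_deriv]
    refine ⟨differentiable_besselSeries k, by simp, ?_⟩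
    rw [show deriv (besselSeries k) = besselSeries (k + 1) from
      funext fun s => (hasDerivAt_besselSeries k s).deriv]
    exact ih (k + 1)

/-- Bessel's equation `s S'' + (k + 1) S' = S` for `S = besselSeries k`, by comparing coefficients:
the factor `m + k + 1` cancels the last factor of `(m + k + 1)!`. -/
theorem besselSeries_recurrence (k : ℕ) (s : ℝ) :
    s * besselSeries (k + 2) s + (k + 1) * besselSeries (k + 1) s = besselSeries k s := by
  have e : s * besselSeries (k + 2) s =
      ∑' m : ℕ, (m : ℝ) * (s ^ m / ((m.factorial : ℝ) * ((m + (k + 1)).factorial : ℝ))) := by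
    rw [Summable.tsum_eq_zero_add]
    · simp only [besselSeries, ← tsum_mul_left, CharP.cast_eq_zero, zero_mul, zero_add]
      refine tsum_congr fun m => ?_
      rw [show m + (k + 2) = m + ((k + 1) + 1) by ring, ← besselSeries_deriv_term]
      ring
    · rw [← summable_nat_add_iff 1]
      refine ((summable_besselSeries (k + 2) s).mul_left s).congr fun m => ?_
      rw [show m + (k + 2) = m + ((k + 1) + 1) by ring, ← besselSeries_deriv_term]
      ring
  have hs : Summable fun m : ℕ =>
      (m : ℝ) * (s ^ m / ((m.factorial : ℝ) * ((m + (k + 1)).factorial : ℝ))) := by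
    rw [← summable_nat_add_iff 1]
    refine ((summable_besselSeries (k + 2) s).mul_left s).congr fun m => ?_
    rw [show m + (k + 2) = m + ((k + 1) + 1) by ring, ← besselSeries_deriv_term]
    ring
  rw [e, besselSeries, besselSeries, ← tsum_mul_left,
    ← hs.tsum_add ((summable_besselSeries (k + 1) s).mul_left _)]
  refine tsum_congr fun m => ?_
  rw [← add_assoc m k 1, Nat.factorial_succ (m + k)]
  have h1 : (m.factorial : ℝ) ≠ 0 := by positivity
  have h2 : ((m + k).factorial : ℝ) ≠ 0 := by positivity
  have h3 : (m + k + 1 : ℝ) ≠ 0 := by positivity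
  push_cast
  field_simp
  ring

theorem besselSeries_zero_arg (k : ℕ) : besselSeries k 0 = 1 / k.factorial := by
  rw [besselSeries, tsum_eq_single 0]
  · simp
  · intro m hm
    simp [hm]

theorem besselSeries_pos (k : ℕ) {s : ℝ} (hs : 0 ≤ s) : 0 < besselSeries k s := by
  refine (summable_besselSeries k s).tsum_pos (fun m => by positivity) 0 ?_
  simp only [pow_zero]
  positivity

/-! ### Bessel functions through the series -/

theorem besselJ_eq (k : ℕ) (x : ℝ) :
    besselJ k x = (x / 2) ^ k * besselSeries k (-(x / 2) ^ 2) := by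
  rw [besselJ, besselSeries, ← tsum_mul_left]
  refine tsum_congr fun m => ?_
  rw [pow_add, neg_pow ((x / 2) ^ 2), ← pow_mul]
  ring

theorem besselI_eq (k : ℕ) (x : ℝ) :
    besselI k x = (x / 2) ^ k * besselSeries k ((x / 2) ^ 2) := by
  rw [besselI, besselSeries, ← tsum_mul_left]
  refine tsum_congr fun m => ?_
  rw [pow_add, ← pow_mul]
  ring

theorem besselJ_zero_eq (x : ℝ) : besselJ 0 x = besselSeries 0 (-(x / 2) ^ 2) := by
  simp [besselJ_eq]

theorem besselI_zero_eq (x : ℝ) : besselI 0 x = besselSeries 0 ((x / 2) ^ 2) := by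
  simp [besselI_eq]

theorem hasDerivAt_besselJ_zero (x : ℝ) : HasDerivAt (besselJ 0) (-besselJ 1 x) x := by
  rw [show besselJ 0 = fun x => besselSeries 0 (-(x / 2) ^ 2) from funext besselJ_zero_eq]
  have h : HasDerivAt (fun x : ℝ => -(x / 2) ^ 2) (-(x / 2)) x := by
    refine (((hasDerivAt_id' x).div_const 2).pow 2).neg.congr_deriv ?_
    ring
  refine ((hasDerivAt_besselSeries 0 (-(x / 2) ^ 2)).comp x h).congr_deriv ?_
  rw [besselJ_eq]
  ring_nf

theorem hasDerivAt_besselI_zero (x : ℝ) : HasDerivAt (besselI 0) (besselI 1 x) x := by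
  rw [show besselI 0 = fun x => besselSeries 0 ((x / 2) ^ 2) from funext besselI_zero_eq]
  have h : HasDerivAt (fun x : ℝ => (x / 2) ^ 2) (x / 2) x := by
    refine (((hasDerivAt_id' x).div_const 2).pow 2).congr_deriv ?_
    ring
  refine ((hasDerivAt_besselSeries 0 ((x / 2) ^ 2)).comp x h).congr_deriv ?_
  rw [besselI_eq]
  ring_nf

theorem continuous_besselJ (k : ℕ) : Continuous (besselJ k) := by
  rw [show besselJ k = _ from funext (besselJ_eq k)]
  exact (by fun_prop : Continuous fun x : ℝ => (x / 2) ^ k).mul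
    ((continuous_besselSeries k).comp (by fun_prop))

theorem continuous_besselI (k : ℕ) : Continuous (besselI k) := by
  rw [show besselI k = _ from funext (besselI_eq k)]
  exact (by fun_prop : Continuous fun x : ℝ => (x / 2) ^ k).mul
    ((continuous_besselSeries k).comp (by fun_prop))

theorem besselI_pos (k : ℕ) {x : ℝ} (hx : 0 < x) : 0 < besselI k x := by
  rw [besselI_eq]
  exact mul_pos (by positivity) (besselSeries_pos k (by positivity))

theorem bucklingDet_zero_eq (κ α : ℝ) :
    bucklingDet 0 κ α =
      κ / α * besselJ 0 α * besselI 1 (κ / α) + α * besselI 0 (κ / α) * besselJ 1 α := by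
  rw [bucklingDet, (hasDerivAt_besselJ_zero _).deriv, (hasDerivAt_besselI_zero _).deriv]
  ring

/-- The classical `(x^{k+1} J_{k+1})' = x^{k+1} J_k` in the variable `t = (x/2)²`. It transfers
positivity from order `k` to order `k + 1`. -/
theorem hasDerivAt_pow_mul_besselSeries_neg (k : ℕ) (t : ℝ) :
    HasDerivAt (fun t => t ^ (k + 1) * besselSeries (k + 1) (-t))
      (t ^ k * besselSeries k (-t)) t := by
  have h := (hasDerivAt_pow (k + 1) t).mul
    ((hasDerivAt_besselSeries (k + 1) (-t)).comp t (hasDerivAt_neg t))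
  refine h.congr_deriv ?_
  rw [← besselSeries_recurrence k (-t)]
  push_cast
  simp only [Function.comp]
  ring

theorem hasDerivAt_mul_besselSeries_one (t : ℝ) :
    HasDerivAt (fun t => t * besselSeries 1 t) (besselSeries 0 t) t := by
  refine ((hasDerivAt_id' t).mul (hasDerivAt_besselSeries 1 t)).congr_deriv ?_
  rw [← besselSeries_recurrence 0 t]
  simp; ring

/-! ### The first positive zero -/

/-- Positivity on `(0, δ)` keeps the zeros away from the excluded point `0`, so the zero set is
closed; the intermediate value theorem places a zero at or before any point where `f ≤ 0`. -/
theorem isLeast_firstPositiveZero {f : ℝ → ℝ} (hf : ContinuousOn f (Set.Ioi 0)) {δ b : ℝ}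
    (hδ : 0 < δ) (hpos : ∀ x, 0 < x → x < δ → 0 < f x) (hb : 0 < b) (hfb : f b ≤ 0) :
    IsLeast (positiveZeros f) (firstPositiveZero f) ∧ firstPositiveZero f ≤ b ∧
      ∀ x, 0 < x → x < firstPositiveZero f → 0 < f x := by
  have hδb : δ ≤ b := by
    by_contra h
    exact absurd (hpos b hb (not_le.1 h)) (not_lt.2 hfb)
  have ivt : ∀ c, 0 < c → f c ≤ 0 → ∃ x ∈ positiveZeros f, x ≤ c := by
    intro c hc hfc
    have h0 : 0 < min (δ / 2) c := lt_min (by linarith) hc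
    have h1 : 0 ≤ f (min (δ / 2) c) := by
      rcases le_or_gt (δ / 2) c with h | h
      · rw [min_eq_left h]
        exact (hpos _ (by linarith) (by linarith)).le
      · exact (hpos _ h0 (lt_of_le_of_lt (min_le_left _ _) (by linarith))).le
    have hc' : ContinuousOn f (Set.Icc (min (δ / 2) c) c) :=
      hf.mono fun x hx => lt_of_lt_of_le h0 hx.1
    obtain ⟨x, hx, hfx⟩ := intermediate_value_Icc' (min_le_right _ _) hc' ⟨hfc, h1⟩
    exact ⟨x, ⟨lt_of_lt_of_le h0 hx.1, hfx⟩, hx.2⟩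
  obtain ⟨x₀, hx₀, hx₀b⟩ := ivt b hb hfb
  have hlb : ∀ x ∈ positiveZeros f, δ ≤ x := by
    intro x hx
    by_contra h
    exact (hpos x hx.1 (not_le.1 h)).ne' hx.2
  have hbdd : BddBelow (positiveZeros f) := ⟨δ, hlb⟩
  have hclosed : IsClosed (positiveZeros f) := by
    have : positiveZeros f = Set.Ici δ ∩ f ⁻¹' {0} := by
      ext x
      exact ⟨fun hx => ⟨hlb x hx, hx.2⟩, fun hx => ⟨lt_of_lt_of_le hδ hx.1, hx.2⟩⟩
    rw [this]
    exact (hf.mono fun x hx => lt_of_lt_of_le hδ hx).preimage_isClosed_of_isClosed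
      isClosed_Ici isClosed_singleton
  have hleast : IsLeast (positiveZeros f) (firstPositiveZero f) :=
    hclosed.isLeast_csInf ⟨x₀, hx₀⟩ hbdd
  refine ⟨hleast, (hleast.2 hx₀).trans hx₀b, fun x hx hlt => ?_⟩
  by_contra h
  obtain ⟨y, hy, hyx⟩ := ivt x hx (not_lt.1 h)
  exact absurd (hleast.2 hy) (not_le.2 (lt_of_le_of_lt hyx hlt))

/-! ### The first positive zero of `J₁` -/

theorem besselJ_one_four_neg : besselJ 1 4 < 0 := by
  rw [besselJ_eq]
  have hs := summable_besselSeries 1 (-(4 / 2 : ℝ) ^ 2)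
  suffices besselSeries 1 (-(4 / 2 : ℝ) ^ 2) < 0 by nlinarith
  rw [besselSeries, ← hs.sum_add_tsum_nat_add 5]
  -- The value in question is the series of order `1` at `-4`. Its first five terms sum to `-1/45`;
  -- the tail is dominated geometrically, using `(m+5)! ≥ 5!·6^m` and `(m+6)! ≥ 6!·7^m`, whence
  -- `120·720` and the ratio `4/42`.
  have hg : HasSum (fun m : ℕ => 4 ^ 5 / (120 * 720) * (4 / 42 : ℝ) ^ m)
      (4 ^ 5 / (120 * 720) * (1 - 4 / 42 : ℝ)⁻¹) :=
    (hasSum_geometric_of_lt_one (by norm_num) (by norm_num)).mul_left _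
  have htail : ∑' m : ℕ, (-(4 / 2 : ℝ) ^ 2) ^ (m + 5) /
      (((m + 5).factorial : ℝ) * ((m + 5 + 1).factorial : ℝ)) ≤
      4 ^ 5 / (120 * 720) * (1 - 4 / 42 : ℝ)⁻¹ := by
    rw [← hg.tsum_eq]
    refine Summable.tsum_le_tsum (fun m => ?_) ((summable_nat_add_iff 5).2 hs) hg.summable
    have h1 : (120 * 6 ^ m : ℝ) ≤ (m + 5).factorial := by
      have := Nat.factorial_mul_pow_le_factorial (m := 5) (n := m)
      rw [add_comm m 5]
      exact_mod_cast this
    have h2 : (720 * 7 ^ m : ℝ) ≤ (m + 5 + 1).factorial := by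
      have := Nat.factorial_mul_pow_le_factorial (m := 6) (n := m)
      rw [show m + 5 + 1 = 6 + m by ring]
      exact_mod_cast this
    calc (-(4 / 2 : ℝ) ^ 2) ^ (m + 5) / (((m + 5).factorial : ℝ) * ((m + 5 + 1).factorial : ℝ))
        ≤ |(-(4 / 2 : ℝ) ^ 2) ^ (m + 5)| /
            (((m + 5).factorial : ℝ) * ((m + 5 + 1).factorial : ℝ)) := by
          gcongr
          exact le_abs_self _
      _ = 4 ^ (m + 5) / (((m + 5).factorial : ℝ) * ((m + 5 + 1).factorial : ℝ)) := by
          rw [abs_pow]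
          norm_num
      _ ≤ 4 ^ (m + 5) / ((120 * 6 ^ m) * (720 * 7 ^ m)) := by gcongr
      _ = 4 ^ 5 / (120 * 720) * (4 / 42 : ℝ) ^ m := by
          rw [show (42 : ℝ) = 6 * 7 by norm_num, div_pow, mul_pow, pow_add]
          field_simp
  have hhead : ∑ m ∈ Finset.range 5, (-(4 / 2 : ℝ) ^ 2) ^ m /
      ((m.factorial : ℝ) * ((m + 1).factorial : ℝ)) = -1 / 45 := by
    simp only [Finset.sum_range_succ, Finset.sum_range_zero, Nat.factorial]
    norm_num
  rw [hhead]
  refine lt_of_le_of_lt (add_le_add_right htail _) ?_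
  norm_num

/-- The function `t^{k+1} S_{k+1}(-t)` vanishes at `0` and has derivative `t^k S_k(-t) > 0`.
Integration gains the closed endpoint `T`, which matters when `T` comes from a zero. -/
theorem besselSeries_succ_neg_pos {k : ℕ} {T : ℝ}
    (h : ∀ t, 0 < t → t < T → 0 < besselSeries k (-t)) :
    ∀ t, 0 < t → t ≤ T → 0 < besselSeries (k + 1) (-t) := by
  intro t ht htT
  have hmono : StrictMonoOn (fun t => t ^ (k + 1) * besselSeries (k + 1) (-t)) (Set.Icc 0 t) := by
    refine strictMonoOn_of_deriv_pos (convex_Icc 0 t)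
      (fun x _ => (hasDerivAt_pow_mul_besselSeries_neg k x).continuousAt.continuousWithinAt) ?_
    intro x hx
    rw [interior_Icc] at hx
    rw [(hasDerivAt_pow_mul_besselSeries_neg k x).deriv]
    exact mul_pos (pow_pos hx.1 k) (h x hx.1 (hx.2.trans_le htT))
  have := hmono ⟨le_rfl, ht.le⟩ ⟨ht.le, le_rfl⟩ ht
  simp only [ne_eq, Nat.add_eq_zero_iff, one_ne_zero, and_false, not_false_eq_true, zero_pow,
    zero_mul] at this
  exact pos_of_mul_pos_right this (by positivity)

theorem besselJ_pos_iff {k : ℕ} {x : ℝ} (hx : 0 < x) :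
    0 < besselJ k x ↔ 0 < besselSeries k (-(x / 2) ^ 2) := by
  rw [besselJ_eq]
  exact mul_pos_iff_of_pos_left (by positivity)

theorem besselJ_zero_zero : besselJ 0 0 = 1 := by
  simp [besselJ_zero_eq, besselSeries_zero_arg]

theorem besselI_zero_zero : besselI 0 0 = 1 := by
  simp [besselI_zero_eq, besselSeries_zero_arg]

theorem exists_besselJ_zero_pos_near_zero :
    ∃ δ, 0 < δ ∧ ∀ x, 0 < x → x < δ → 0 < besselJ 0 x := by
  have h : ∀ᶠ x in 𝓝 (0 : ℝ), 0 < besselJ 0 x :=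
    (continuous_besselJ 0).continuousAt.eventually (lt_mem_nhds (by rw [besselJ_zero_zero]; norm_num))
  obtain ⟨δ, hδ, h⟩ := Metric.eventually_nhds_iff.1 h
  refine ⟨δ, hδ, fun x hx hxδ => h ?_⟩
  rwa [Real.dist_eq, sub_zero, abs_of_pos hx]

theorem besselJ_one_pos_of_besselJ_zero_pos {a : ℝ} (h : ∀ x, 0 < x → x < a → 0 < besselJ 0 x) :
    ∀ x, 0 < x → x ≤ a → 0 < besselJ 1 x := by
  intro x hx hxa
  rw [besselJ_pos_iff hx]
  refine besselSeries_succ_neg_pos (k := 0) (T := (a / 2) ^ 2) (fun t ht htT => ?_) _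
    (by positivity) (by gcongr)
  -- Return to the Bessel variable: `t = (x/2)²` with `x = 2√t`.
  have h1 : t = (2 * √t / 2) ^ 2 := by
    rw [mul_div_cancel_left₀ _ (by norm_num : (2 : ℝ) ≠ 0), Real.sq_sqrt ht.le]
  rw [h1, ← besselJ_zero_eq]
  refine h _ (by positivity) ?_
  rw [h1] at htT
  have := lt_of_pow_lt_pow_left₀ 2 (by linarith) htT
  linarith

theorem isLeast_jOneOne_and_pos : IsLeast (positiveZeros (besselJ 1)) jOneOne ∧
    ∀ x, 0 < x → x < jOneOne → 0 < besselJ 1 x := by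
  obtain ⟨δ, hδ, h⟩ := exists_besselJ_zero_pos_near_zero
  have := isLeast_firstPositiveZero (continuous_besselJ 1).continuousOn hδ
    (fun x hx hxδ => besselJ_one_pos_of_besselJ_zero_pos h x hx hxδ.le)
    (by norm_num : (0 : ℝ) < 4) besselJ_one_four_neg.le
  exact ⟨this.1, this.2.2⟩

theorem jOneOne_pos : 0 < jOneOne := isLeast_jOneOne_and_pos.1.1.1

theorem besselJ_one_jOneOne : besselJ 1 jOneOne = 0 := isLeast_jOneOne_and_pos.1.1.2

theorem besselJ_one_pos {x : ℝ} (hx : 0 < x) (hxj : x < jOneOne) : 0 < besselJ 1 x :=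
  isLeast_jOneOne_and_pos.2 x hx hxj

/-- Induction from `J_1`: no `J_k` with `k ≥ 1` vanishes in `(0, j_{1,1})`. This is what excludes
the nonradial modes. -/
theorem besselSeries_neg_pos {k : ℕ} (hk : 1 ≤ k) {t : ℝ} (ht : 0 < t)
    (htj : t < (jOneOne / 2) ^ 2) : 0 < besselSeries k (-t) := by
  induction k, hk using Nat.le_induction generalizing t with
  | base =>
    have h1 : t = (2 * √t / 2) ^ 2 := by
      rw [mul_div_cancel_left₀ _ (by norm_num : (2 : ℝ) ≠ 0), Real.sq_sqrt ht.le]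
    rw [h1, ← besselJ_pos_iff (by positivity)]
    refine besselJ_one_pos (by positivity) ?_
    rw [h1] at htj
    have := lt_of_pow_lt_pow_left₀ 2 (by linarith [jOneOne_pos]) htj
    linarith
  | succ k hk ih => exact besselSeries_succ_neg_pos (fun t ht htT => ih ht htT) t ht htj.le

theorem strictAntiOn_besselJ_zero : StrictAntiOn (besselJ 0) (Set.Icc 0 jOneOne) := by
  refine strictAntiOn_of_deriv_neg (convex_Icc _ _) (continuous_besselJ 0).continuousOn ?_
  intro x hx
  rw [interior_Icc] at hx
  rw [(hasDerivAt_besselJ_zero x).deriv]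
  linarith [besselJ_one_pos hx.1 hx.2]

/-- Otherwise `J_0`, which decreases on `[0, j_{1,1}]`, would be positive before `j_{1,1}`, and
integrating it would give `J_1(j_{1,1}) > 0`. -/
theorem besselJ_zero_jOneOne_neg : besselJ 0 jOneOne < 0 := by
  by_contra hcon
  have h : ∀ x, 0 < x → x < jOneOne → 0 < besselJ 0 x := fun x hx hxj =>
    lt_of_le_of_lt (not_lt.1 hcon)
      (strictAntiOn_besselJ_zero ⟨hx.le, hxj.le⟩ ⟨jOneOne_pos.le, le_rfl⟩ hxj)
  exact (besselJ_one_pos_of_besselJ_zero_pos h jOneOne jOneOne_pos le_rfl).ne' besselJ_one_jOneOne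

/-! ### The first positive zero of `F₀` -/

theorem continuousOn_bucklingDet_zero (κ : ℝ) : ContinuousOn (bucklingDet 0 κ) (Set.Ioi 0) := by
  rw [show bucklingDet 0 κ = _ from funext (bucklingDet_zero_eq κ)]
  have h : ContinuousOn (fun α : ℝ => κ / α) (Set.Ioi 0) :=
    continuousOn_const.div continuousOn_id fun x hx => (ne_of_gt hx)
  exact ((h.mul (continuous_besselJ 0).continuousOn).mul
    ((continuous_besselI 1).comp_continuousOn h)).add
    ((continuousOn_id.mul ((continuous_besselI 0).comp_continuousOn h)).mul
      (continuous_besselJ 1).continuousOn)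

/-- Near `0` both `J_0` and `J_1` are positive, hence so is `F_0`; any point with `F_0 ≤ 0` then
bounds the first root from above. -/
theorem alphaZeroOne_spec {κ b : ℝ} (hκ : 0 < κ) (hb : 0 < b) (hfb : bucklingDet 0 κ b ≤ 0) :
    IsLeast (positiveZeros (bucklingDet 0 κ)) (alphaZeroOne κ) ∧ alphaZeroOne κ ≤ b := by
  obtain ⟨δ, hδ, h⟩ := exists_besselJ_zero_pos_near_zero
  have := isLeast_firstPositiveZero (continuousOn_bucklingDet_zero κ) hδ (fun x hx hxδ => ?_) hb hfb
  · exact ⟨this.1, this.2.1⟩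
  · rw [bucklingDet_zero_eq]
    have h0 := h x hx hxδ
    have h1 := besselJ_one_pos_of_besselJ_zero_pos h x hx hxδ.le
    have h2 := besselI_pos 0 (div_pos hκ hx)
    have h3 := besselI_pos 1 (div_pos hκ hx)
    positivity

theorem bucklingDet_zero_jOneOne_neg {κ : ℝ} (hκ : 0 < κ) : bucklingDet 0 κ jOneOne < 0 := by
  rw [bucklingDet_zero_eq, besselJ_one_jOneOne, mul_zero, add_zero]
  have h := div_pos hκ jOneOne_pos
  exact mul_neg_of_neg_of_pos (mul_neg_of_pos_of_neg h besselJ_zero_jOneOne_neg) (besselI_pos 1 h)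

theorem isLeast_alphaZeroOne {κ : ℝ} (hκ : 0 < κ) :
    IsLeast (positiveZeros (bucklingDet 0 κ)) (alphaZeroOne κ) :=
  (alphaZeroOne_spec hκ jOneOne_pos (bucklingDet_zero_jOneOne_neg hκ).le).1

theorem alphaZeroOne_pos {κ : ℝ} (hκ : 0 < κ) : 0 < alphaZeroOne κ := (isLeast_alphaZeroOne hκ).1.1

theorem bucklingDet_zero_alphaZeroOne {κ : ℝ} (hκ : 0 < κ) :
    bucklingDet 0 κ (alphaZeroOne κ) = 0 := (isLeast_alphaZeroOne hκ).1.2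

theorem alphaZeroOne_lt_of_neg {κ b : ℝ} (hκ : 0 < κ) (hb : 0 < b) (hfb : bucklingDet 0 κ b < 0) :
    alphaZeroOne κ < b := by
  refine lt_of_le_of_ne (alphaZeroOne_spec hκ hb hfb.le).2 fun h => ?_
  rw [← h, bucklingDet_zero_alphaZeroOne hκ] at hfb
  exact lt_irrefl _ hfb

theorem alphaZeroOne_lt_jOneOne {κ : ℝ} (hκ : 0 < κ) : alphaZeroOne κ < jOneOne :=
  alphaZeroOne_lt_of_neg hκ jOneOne_pos (bucklingDet_zero_jOneOne_neg hκ)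

/-! ### Monotonicity and limits -/

/-- `x ↦ x I₁(x) / I₀(x)` is strictly increasing on the positive half-line. -/
theorem strictMonoOn_besselI_quotient :
    StrictMonoOn (fun x => x * besselI 1 x / besselI 0 x) (Set.Ioi 0) := by
  -- This `D` is the numerator of the derivative of `t S_1/S_0`, because `(t S_1)' = S_0`. The
  -- recurrence collapses `D'` to `S_1² ≥ 0`, and `D(0) = 1`.
  have hD : ∀ t : ℝ, HasDerivAt (fun t => besselSeries 0 t ^ 2 - t * besselSeries 1 t ^ 2)
      (besselSeries 1 t ^ 2) t := by
    intro t
    refine (((hasDerivAt_besselSeries 0 t).pow 2).sub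
      ((hasDerivAt_id' t).mul ((hasDerivAt_besselSeries 1 t).pow 2))).congr_deriv ?_
    have := besselSeries_recurrence 0 t
    simp only [CharP.cast_eq_zero, zero_add, one_mul] at this
    rw [← this]
    simp only [zero_add, Nat.reduceAdd, Pi.pow_apply]
    push_cast
    ring
  have hDpos : ∀ t : ℝ, 0 ≤ t → 0 < besselSeries 0 t ^ 2 - t * besselSeries 1 t ^ 2 := by
    intro t ht
    have hmono : MonotoneOn (fun t => besselSeries 0 t ^ 2 - t * besselSeries 1 t ^ 2)
        (Set.Ici 0) := by
      refine monotoneOn_of_deriv_nonneg (convex_Ici 0)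
        (fun x _ => (hD x).continuousAt.continuousWithinAt)
        (fun x _ => (hD x).differentiableAt.differentiableWithinAt) fun x _ => ?_
      rw [(hD x).deriv]
      positivity
    have := hmono Set.self_mem_Ici ht ht
    simp only [besselSeries_zero_arg] at this
    norm_num at this
    linarith
  have hH : StrictMonoOn (fun t => t * besselSeries 1 t / besselSeries 0 t) (Set.Ici 0) := by
    have hd : ∀ t : ℝ, 0 ≤ t → HasDerivAt (fun t => t * besselSeries 1 t / besselSeries 0 t)
        ((besselSeries 0 t ^ 2 - t * besselSeries 1 t ^ 2) / besselSeries 0 t ^ 2) t := by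
      intro t ht
      refine ((hasDerivAt_mul_besselSeries_one t).div (hasDerivAt_besselSeries 0 t)
        (besselSeries_pos 0 ht).ne').congr_deriv ?_
      ring
    refine strictMonoOn_of_deriv_pos (convex_Ici 0)
      (fun x hx => (hd x hx).continuousAt.continuousWithinAt) fun x hx => ?_
    rw [interior_Ici] at hx
    rw [(hd x (le_of_lt hx)).deriv]
    exact div_pos (hDpos x (le_of_lt hx)) (pow_pos (besselSeries_pos 0 (le_of_lt hx)) 2)
  have he : ∀ x : ℝ, x * besselI 1 x / besselI 0 x =
      2 * ((x / 2) ^ 2 * besselSeries 1 ((x / 2) ^ 2) / besselSeries 0 ((x / 2) ^ 2)) := by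
    intro x
    rw [besselI_eq, besselI_eq]
    ring
  intro x hx y hy hxy
  simp only [Set.mem_Ioi] at hx hy
  simp only [he]
  have := hH (Set.mem_Ici.2 (sq_nonneg (x / 2))) (Set.mem_Ici.2 (sq_nonneg (y / 2))) (by gcongr)
  simp only at this
  linarith

/-- The equation `F_0 = 0` divided by `I_0`: all dependence on `κ` at fixed `α` now sits in the
monotone quotient. -/
theorem besselI_quotient_alphaZeroOne {κ : ℝ} (hκ : 0 < κ) :
    κ / alphaZeroOne κ * besselI 1 (κ / alphaZeroOne κ) / besselI 0 (κ / alphaZeroOne κ) *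
      besselJ 0 (alphaZeroOne κ) = - (alphaZeroOne κ * besselJ 1 (alphaZeroOne κ)) := by
  have h := bucklingDet_zero_alphaZeroOne hκ
  rw [bucklingDet_zero_eq] at h
  have h0 := (besselI_pos 0 (div_pos hκ (alphaZeroOne_pos hκ))).ne'
  rw [div_mul_eq_mul_div, div_eq_iff h0]
  linarith

theorem besselJ_zero_alphaZeroOne_neg {κ : ℝ} (hκ : 0 < κ) : besselJ 0 (alphaZeroOne κ) < 0 := by
  have hα := alphaZeroOne_pos hκ
  have h := besselI_quotient_alphaZeroOne hκ
  have h1 := besselJ_one_pos hα (alphaZeroOne_lt_jOneOne hκ)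
  have h2 := besselI_pos 1 (div_pos hκ hα)
  have h3 := besselI_pos 0 (div_pos hκ hα)
  by_contra hcon
  have h4 : 0 < alphaZeroOne κ * besselJ 1 (alphaZeroOne κ) := mul_pos hα h1
  have h5 : 0 ≤ κ / alphaZeroOne κ * besselI 1 (κ / alphaZeroOne κ) /
      besselI 0 (κ / alphaZeroOne κ) * besselJ 0 (alphaZeroOne κ) :=
    mul_nonneg (by positivity) (not_lt.1 hcon)
  linarith

/-- At the root for `κ`, replacing `κ` by a larger `κ'` increases the quotient, which is multiplied
by the negative number `J_0(α)`. So the determinant for `κ'` is negative there and its first root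
comes earlier. -/
theorem strictAntiOn_alphaZeroOne : StrictAntiOn alphaZeroOne (Set.Ioi 0) := by
  intro κ hκ κ' hκ' hlt
  simp only [Set.mem_Ioi] at hκ hκ'
  have hα := alphaZeroOne_pos hκ
  refine alphaZeroOne_lt_of_neg hκ' hα ?_
  have hβ := div_pos hκ' hα
  have h := besselI_quotient_alphaZeroOne hκ
  have h1 : κ / alphaZeroOne κ < κ' / alphaZeroOne κ := by gcongr
  have h2 := strictMonoOn_besselI_quotient (Set.mem_Ioi.2 (div_pos hκ hα)) (Set.mem_Ioi.2 hβ) h1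
  have h3 := mul_lt_mul_of_neg_right h2 (besselJ_zero_alphaZeroOne_neg hκ)
  simp only at h3
  rw [h, div_mul_eq_mul_div, div_lt_iff₀ (besselI_pos 0 hβ)] at h3
  rw [bucklingDet_zero_eq]
  linarith

theorem tendsto_alphaZeroOne : Tendsto alphaZeroOne (𝓝[>] 0) (𝓝 jOneOne) := by
  rw [tendsto_order]
  refine ⟨fun c hc => ?_, fun c hc => ?_⟩
  swap
  · filter_upwards [self_mem_nhdsWithin] with κ hκ
    exact (alphaZeroOne_lt_jOneOne hκ).trans hc
  -- If the root stayed below `c < j_{1,1}` for some `κ < 1`, it would lie in `[a, c]`, where `J_1`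
  -- has a positive minimum `m`. But the root equation bounds `α J_1(α)` by the function in `hlim`,
  -- uniform in the root, which tends to `0`.
  set a := alphaZeroOne 1
  have ha : 0 < a := alphaZeroOne_pos one_pos
  obtain ⟨m, hm, hmle⟩ : ∃ m, 0 < m ∧ ∀ x ∈ Set.Icc a c, m ≤ besselJ 1 x := by
    rcases (Set.Icc a c).eq_empty_or_nonempty with he | hne
    · exact ⟨1, one_pos, by simp [he]⟩
    · obtain ⟨x, hx, hmin⟩ := isCompact_Icc.exists_isMinOn hne (continuous_besselJ 1).continuousOn
      exact ⟨besselJ 1 x, besselJ_one_pos (ha.trans_le hx.1) (hx.2.trans_lt hc), hmin⟩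
  have hlim : Tendsto (fun κ : ℝ => κ / a * besselI 1 (κ / a) / besselI 0 (κ / a) *
      -besselJ 0 jOneOne) (𝓝[>] 0) (𝓝 0) := by
    have hc : ContinuousAt (fun κ : ℝ => κ / a * besselI 1 (κ / a) / besselI 0 (κ / a) *
      -besselJ 0 jOneOne) 0 := by
      have h1 : ContinuousAt (fun κ : ℝ => κ / a) 0 := by fun_prop
      refine ContinuousAt.mul (ContinuousAt.div (h1.mul ?_) ?_ ?_) continuousAt_const
      · exact ((continuous_besselI 1).comp (by fun_prop : Continuous fun κ => κ / a)).continuousAt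
      · exact ((continuous_besselI 0).comp (by fun_prop : Continuous fun κ => κ / a)).continuousAt
      · simp [besselI_zero_zero]
    have := hc.tendsto
    simp only [zero_div, zero_mul] at this
    exact this.mono_left nhdsWithin_le_nhds
  filter_upwards [hlim.eventually (gt_mem_nhds (mul_pos ha hm)), self_mem_nhdsWithin,
    mem_nhdsWithin_of_mem_nhds (gt_mem_nhds (zero_lt_one : (0 : ℝ) < 1))] with κ hκl hκ hκ1
  simp only [Set.mem_Ioi] at hκ
  by_contra hcon
  have hα := alphaZeroOne_pos hκ
  have haα : a < alphaZeroOne κ := strictAntiOn_alphaZeroOne hκ (Set.mem_Ioi.2 one_pos) hκ1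
  have h1 := besselI_quotient_alphaZeroOne hκ
  have h2 : m ≤ besselJ 1 (alphaZeroOne κ) := hmle _ ⟨haα.le, not_lt.1 hcon⟩
  have h3 : κ / alphaZeroOne κ < κ / a := by gcongr
  have h4 := strictMonoOn_besselI_quotient (Set.mem_Ioi.2 (div_pos hκ hα))
    (Set.mem_Ioi.2 (div_pos hκ ha)) h3
  simp only at h4
  have h5 : besselJ 0 jOneOne < besselJ 0 (alphaZeroOne κ) :=
    strictAntiOn_besselJ_zero ⟨hα.le, (alphaZeroOne_lt_jOneOne hκ).le⟩ ⟨jOneOne_pos.le, le_rfl⟩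
      (alphaZeroOne_lt_jOneOne hκ)
  have h6 : a * m ≤ alphaZeroOne κ * besselJ 1 (alphaZeroOne κ) := by gcongr
  have h7 := besselI_pos 1 (div_pos hκ ha)
  have h8 := besselI_pos 0 (div_pos hκ ha)
  have h9 : κ / alphaZeroOne κ * besselI 1 (κ / alphaZeroOne κ) / besselI 0 (κ / alphaZeroOne κ) *
      -besselJ 0 (alphaZeroOne κ) ≤
      κ / a * besselI 1 (κ / a) / besselI 0 (κ / a) * -besselJ 0 jOneOne :=
    mul_le_mul h4.le (by linarith) (by linarith [besselJ_zero_alphaZeroOne_neg hκ])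
      (by positivity)
  linarith

/-- The weak inequality `κ ≤ κ'` allows both uses: varying `κ`, and comparing two values of `α` at
the same `κ`. -/
theorem sq_sub_sq_div_lt {κ κ' a a' : ℝ} (hκ : 0 < κ) (hκκ' : κ ≤ κ') (ha' : 0 < a')
    (h : a' < a) : a' ^ 2 - κ' ^ 2 / a' ^ 2 < a ^ 2 - κ ^ 2 / a ^ 2 := by
  have h1 : a' ^ 2 < a ^ 2 := by gcongr
  have h2 : κ ^ 2 / a ^ 2 ≤ κ' ^ 2 / a' ^ 2 := by gcongr
  linarith

theorem strictAntiOn_lambda :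
    StrictAntiOn (fun κ => alphaZeroOne κ ^ 2 - κ ^ 2 / alphaZeroOne κ ^ 2) (Set.Ioi 0) :=
  fun _ hκ _ hκ' hlt => sq_sub_sq_div_lt hκ hlt.le (alphaZeroOne_pos hκ')
    (strictAntiOn_alphaZeroOne hκ hκ' hlt)

theorem tendsto_lambda_zero :
    Tendsto (fun κ => alphaZeroOne κ ^ 2 - κ ^ 2 / alphaZeroOne κ ^ 2) (𝓝[>] 0)
      (𝓝 (jOneOne ^ 2)) := by
  have hid : Tendsto (fun κ : ℝ => κ ^ 2) (𝓝[>] 0) (𝓝 0) := by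
    have : ContinuousAt (fun κ : ℝ => κ ^ 2) 0 := by fun_prop
    simpa using this.tendsto.mono_left nhdsWithin_le_nhds
  have h := (tendsto_alphaZeroOne.pow 2).sub (hid.div (tendsto_alphaZeroOne.pow 2)
    (pow_pos jOneOne_pos 2).ne')
  simpa using h

theorem tendsto_lambda_atTop :
    Tendsto (fun κ => alphaZeroOne κ ^ 2 - κ ^ 2 / alphaZeroOne κ ^ 2) atTop atBot := by
  have hj := jOneOne_pos
  have h : Tendsto (fun κ : ℝ => jOneOne ^ 2 + -(κ ^ 2 / jOneOne ^ 2)) atTop atBot :=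
    tendsto_atBot_add_const_left _ _ (tendsto_neg_atTop_atBot.comp
      ((tendsto_pow_atTop two_ne_zero).atTop_div_const (by positivity)))
  refine tendsto_atBot_mono' _ ?_ h
  filter_upwards [eventually_gt_atTop 0] with κ hκ
  have := sq_sub_sq_div_lt hκ le_rfl (alphaZeroOne_pos hκ) (alphaZeroOne_lt_jOneOne hκ)
  linarith

/-! ### Polar coordinates -/

/-- The radial unit vector at angle `θ`. -/
noncomputable def radialUnit (θ : ℝ) : Plane := !₂[Real.cos θ, Real.sin θ]

/-- The tangential unit vector at angle `θ`. -/
noncomputable def tangentialUnit (θ : ℝ) : Plane := !₂[-Real.sin θ, Real.cos θ]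

theorem Plane.hasDerivAt_iff {f : ℝ → Plane} {f' : Plane} {t : ℝ} :
    HasDerivAt f f' t ↔ ∀ i, HasDerivAt (fun t => f t i) (f' i) t := by
  simp only [← hasDerivWithinAt_univ, hasDerivWithinAt_iff_hasFDerivWithinAt,
    hasFDerivWithinAt_euclidean]
  refine forall_congr' fun i => ?_
  rw [show PiLp.proj 2 (fun _ : Fin 2 => ℝ) i ∘L ContinuousLinearMap.toSpanSingleton ℝ f' =
    ContinuousLinearMap.toSpanSingleton ℝ (f' i) by ext; simp]

theorem norm_radialUnit (θ : ℝ) : ‖radialUnit θ‖ = 1 := by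
  simp [radialUnit, EuclideanSpace.norm_eq, Fin.sum_univ_two]

theorem hasDerivAt_radialUnit (θ : ℝ) : HasDerivAt radialUnit (tangentialUnit θ) θ := by
  rw [Plane.hasDerivAt_iff]
  intro i
  fin_cases i
  · simpa [radialUnit, tangentialUnit] using Real.hasDerivAt_cos θ
  · simpa [radialUnit, tangentialUnit] using Real.hasDerivAt_sin θ

theorem hasDerivAt_tangentialUnit (θ : ℝ) : HasDerivAt tangentialUnit (-radialUnit θ) θ := by
  rw [Plane.hasDerivAt_iff]
  intro i
  fin_cases i
  · simpa [radialUnit, tangentialUnit] using (Real.hasDerivAt_sin θ).fun_neg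
  · simpa [radialUnit, tangentialUnit] using Real.hasDerivAt_cos θ

theorem continuous_radialUnit : Continuous radialUnit :=
  continuous_iff_continuousAt.2 fun θ => (hasDerivAt_radialUnit θ).continuousAt

theorem continuous_tangentialUnit : Continuous tangentialUnit :=
  continuous_iff_continuousAt.2 fun θ => (hasDerivAt_tangentialUnit θ).continuousAt

theorem radialUnit_add_two_pi (θ : ℝ) : radialUnit (θ + 2 * Real.pi) = radialUnit θ := by
  simp [radialUnit]

theorem exists_eq_smul_radialUnit (x : Plane) : ∃ θ, x = ‖x‖ • radialUnit θ := by
  refine ⟨Complex.arg ⟨x 0, x 1⟩, ?_⟩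
  have hn : ‖(⟨x 0, x 1⟩ : ℂ)‖ = ‖x‖ := by
    rw [Complex.norm_eq_sqrt_sq_add_sq, EuclideanSpace.norm_eq, Fin.sum_univ_two]
    simp
  ext i
  fin_cases i
  · simp [radialUnit, ← hn]
  · simp [radialUnit, ← hn]

theorem smul_radialUnit_mem_ball {r : ℝ} (hr : r ∈ Set.Ioo (-1 : ℝ) 1) (θ : ℝ) :
    r • radialUnit θ ∈ ball (0 : Plane) 1 := by
  rw [mem_ball_zero_iff, norm_smul, norm_radialUnit, mul_one, Real.norm_eq_abs, abs_lt]
  exact hr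

theorem smul_radialUnit_mem_closedBall {r : ℝ} (hr : r ∈ Set.Icc (0 : ℝ) 1) (θ : ℝ) :
    r • radialUnit θ ∈ closedBall (0 : Plane) 1 := by
  rw [mem_closedBall_zero_iff, norm_smul, norm_radialUnit, mul_one, Real.norm_eq_abs,
    abs_of_nonneg hr.1]
  exact hr.2

/-- The trace of the Hessian is the same in every orthonormal frame; the frame adapted to angle `θ`
gives the Laplacian in polar form. -/
theorem laplacian_eq_fderiv_fderiv {F : Type*} [NormedAddCommGroup F] [NormedSpace ℝ F]
    (v : Plane → F) (x : Plane) (θ : ℝ) :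
    Δ v x = fderiv ℝ (fderiv ℝ v) x (radialUnit θ) (radialUnit θ) +
      fderiv ℝ (fderiv ℝ v) x (tangentialUnit θ) (tangentialUnit θ) := by
  have hr : radialUnit θ = Real.cos θ • EuclideanSpace.single 0 1 +
      Real.sin θ • EuclideanSpace.single 1 1 := by
    ext i; fin_cases i <;> simp [radialUnit]
  have ht : tangentialUnit θ = -Real.sin θ • EuclideanSpace.single 0 1 +
      Real.cos θ • EuclideanSpace.single 1 1 := by
    ext i; fin_cases i <;> simp [tangentialUnit]
  rw [InnerProductSpace.laplacian_eq_iteratedFDeriv_orthonormalBasis v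
    (EuclideanSpace.basisFun (Fin 2) ℝ), hr, ht]
  simp only [iteratedFDeriv_two_apply, Fin.sum_univ_two, EuclideanSpace.basisFun_apply, map_add,
    map_smul, add_apply, smul_apply, Matrix.cons_val_zero,
    Matrix.cons_val_one]
  have hsq := Real.sin_sq_add_cos_sq θ
  set A := fderiv ℝ (fderiv ℝ v) x (EuclideanSpace.single 0 1) (EuclideanSpace.single 0 1)
  set B := fderiv ℝ (fderiv ℝ v) x (EuclideanSpace.single 1 1) (EuclideanSpace.single 1 1)
  have h1 : A + B = (Real.sin θ ^ 2 + Real.cos θ ^ 2) • A +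
    (Real.sin θ ^ 2 + Real.cos θ ^ 2) • B := by rw [hsq]; simp
  rw [h1]
  module

/-! ### Integrals depending on a parameter -/

theorem hasDerivAt_intervalIntegral_of_continuousOn {F F' : ℝ → ℝ → ℝ} {U : Set ℝ} (hU : IsOpen U)
    (hF : ContinuousOn (Function.uncurry F) (U ×ˢ Set.univ))
    (hF' : ContinuousOn (Function.uncurry F') (U ×ˢ Set.univ))
    (hderiv : ∀ r ∈ U, ∀ θ, HasDerivAt (fun r => F r θ) (F' r θ) r) (a b : ℝ) {r : ℝ}
    (hr : r ∈ U) :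
    HasDerivAt (fun r => ∫ θ in a..b, F r θ) (∫ θ in a..b, F' r θ) r := by
  obtain ⟨ε, hε, hεU⟩ := Metric.nhds_basis_closedBall.mem_iff.1 (hU.mem_nhds hr)
  have hslice : ∀ {G : ℝ → ℝ → ℝ}, ContinuousOn (Function.uncurry G) (U ×ˢ Set.univ) →
      ∀ s ∈ U, Continuous (G s) := fun hG s hs =>
    hG.comp_continuous (f := fun θ : ℝ => (s, θ)) (by fun_prop) fun θ => ⟨hs, trivial⟩
  obtain ⟨C, hC⟩ := ((isCompact_closedBall r ε).prod (isCompact_uIcc (a := a)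
    (b := b))).exists_bound_of_continuousOn (hF'.mono (Set.prod_mono hεU (Set.subset_univ _)))
  refine (intervalIntegral.hasDerivAt_integral_of_dominated_loc_of_deriv_le (bound := fun _ => C)
    (closedBall_mem_nhds r hε) ?_ ((hslice hF r hr).intervalIntegrable _ _)
    (hslice hF' r hr).aestronglyMeasurable ?_ intervalIntegrable_const ?_).2
  · filter_upwards [hU.mem_nhds hr] with s hs using (hslice hF s hs).aestronglyMeasurable
  · exact Eventually.of_forall fun θ hθ s hs => hC (s, θ) ⟨hs, Set.uIoc_subset_uIcc hθ⟩
  · exact Eventually.of_forall fun θ _ s hs => hderiv s (hεU hs) θ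

/-- Freezing `F` beyond the endpoints, through the projection onto `[0, 1]`, gives a globally
continuous integrand. -/
theorem continuousOn_intervalIntegral_Icc {F : ℝ → ℝ → ℝ}
    (hF : ContinuousOn (Function.uncurry F) (Set.Icc 0 1 ×ˢ Set.univ)) (a b : ℝ) :
    ContinuousOn (fun r => ∫ θ in a..b, F r θ) (Set.Icc 0 1) := by
  have h01 : (0 : ℝ) ≤ 1 := zero_le_one
  have hG : Continuous (Function.uncurry fun r θ => F (Set.projIcc 0 1 h01 r) θ) :=
    hF.comp_continuous (f := fun p : ℝ × ℝ => ((Set.projIcc 0 1 h01 p.1 : ℝ), p.2))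
      (by fun_prop) fun p => ⟨(Set.projIcc 0 1 h01 p.1).2, trivial⟩
  have hc := intervalIntegral.continuous_parametric_intervalIntegral_of_continuous'
    (μ := MeasureTheory.volume) hG a b
  refine hc.continuousOn.congr fun r hr => ?_
  simp only [Set.projIcc_of_mem h01 hr]

/-! ### Angular modes -/

/-- `g` is a `2π`-periodic solution of `g'' = -k² g`. -/
structure IsAngularMode (k : ℕ) (g g' : ℝ → ℝ) : Prop where
  deriv_eq : ∀ θ, HasDerivAt g (g' θ) θ
  deriv_deriv_eq : ∀ θ, HasDerivAt g' (-(k : ℝ) ^ 2 * g θ) θ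
  periodic : g (2 * Real.pi) = g 0
  periodic_deriv : g' (2 * Real.pi) = g' 0

theorem IsAngularMode.continuous {k : ℕ} {g g' : ℝ → ℝ} (hg : IsAngularMode k g g') :
    Continuous g := continuous_iff_continuousAt.2 fun θ => (hg.deriv_eq θ).continuousAt

theorem IsAngularMode.continuous_deriv {k : ℕ} {g g' : ℝ → ℝ} (hg : IsAngularMode k g g') :
    Continuous g' := continuous_iff_continuousAt.2 fun θ => (hg.deriv_deriv_eq θ).continuousAt

theorem isAngularMode_cos (k : ℕ) :
    IsAngularMode k (fun θ => Real.cos (k * θ)) (fun θ => -(k * Real.sin (k * θ))) where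
  deriv_eq θ := by
    refine ((Real.hasDerivAt_cos (k * θ)).comp θ ((hasDerivAt_id' θ).const_mul (k : ℝ))).congr_deriv ?_
    ring
  deriv_deriv_eq θ := by
    refine (((Real.hasDerivAt_sin (k * θ)).comp θ
      ((hasDerivAt_id' θ).const_mul (k : ℝ))).const_mul (k : ℝ)).neg.congr_deriv ?_
    ring
  periodic := by simp [Real.cos_nat_mul_two_pi]
  periodic_deriv := by
    have := Real.sin_periodic.nat_mul k 0
    simp only [zero_add] at this
    simp [this]

theorem isAngularMode_sin (k : ℕ) :
    IsAngularMode k (fun θ => Real.sin (k * θ)) (fun θ => k * Real.cos (k * θ)) where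
  deriv_eq θ := by
    refine ((Real.hasDerivAt_sin (k * θ)).comp θ ((hasDerivAt_id' θ).const_mul (k : ℝ))).congr_deriv ?_
    ring
  deriv_deriv_eq θ := by
    refine (((Real.hasDerivAt_cos (k * θ)).comp θ
      ((hasDerivAt_id' θ).const_mul (k : ℝ))).const_mul (k : ℝ)).congr_deriv ?_
    ring
  periodic := by
    have := Real.sin_periodic.nat_mul k 0
    simp only [zero_add] at this
    simp [this]
  periodic_deriv := by simp [Real.cos_nat_mul_two_pi]

/-- The component of `v` along the angular function `g`, on the circle of radius `r`. -/
noncomputable def angularComponent (g : ℝ → ℝ) (v : Plane → ℝ) (r : ℝ) : ℝ :=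
  ∫ θ in (0 : ℝ)..(2 * Real.pi), g θ * v (r • radialUnit θ)

/-- The component along `g` of the radial derivative of `v`. -/
noncomputable def angularComponentDeriv (g : ℝ → ℝ) (v : Plane → ℝ) (r : ℝ) : ℝ :=
  ∫ θ in (0 : ℝ)..(2 * Real.pi), g θ * fderiv ℝ v (r • radialUnit θ) (radialUnit θ)

/-- The component along `g` of the second radial derivative of `v`. -/
noncomputable def angularComponentDerivTwo (g : ℝ → ℝ) (v : Plane → ℝ) (r : ℝ) : ℝ :=
  ∫ θ in (0 : ℝ)..(2 * Real.pi),
    g θ * fderiv ℝ (fderiv ℝ v) (r • radialUnit θ) (radialUnit θ) (radialUnit θ)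

section

variable {k : ℕ} {g g' : ℝ → ℝ} {v : Plane → ℝ}

theorem continuous_smul_radialUnit : Continuous fun p : ℝ × ℝ => p.1 • radialUnit p.2 :=
  continuous_fst.smul (continuous_radialUnit.comp continuous_snd)

theorem ContinuousOn.comp_polar {F : Type*} [TopologicalSpace F] {f : Plane → F}
    (hf : ContinuousOn f (ball 0 1)) :
    ContinuousOn (fun p : ℝ × ℝ => f (p.1 • radialUnit p.2)) (Set.Ioo (-1) 1 ×ˢ Set.univ) :=
  hf.comp continuous_smul_radialUnit.continuousOn fun p hp => smul_radialUnit_mem_ball hp.1 p.2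

theorem ContDiffOn.continuousOn_fderiv_ball (hv : ContDiffOn ℝ 1 v (ball 0 1)) :
    ContinuousOn (fderiv ℝ v) (ball 0 1) :=
  hv.continuousOn_fderiv_of_isOpen isOpen_ball le_rfl

theorem ContDiffOn.contDiffOn_fderiv_ball (hv : ContDiffOn ℝ 2 v (ball 0 1)) :
    ContDiffOn ℝ 1 (fderiv ℝ v) (ball 0 1) :=
  hv.fderiv_of_isOpen isOpen_ball (by norm_num)

theorem hasDerivAt_smul_radialUnit (r θ : ℝ) :
    HasDerivAt (fun r : ℝ => r • radialUnit θ) (radialUnit θ) r := by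
  simpa using (hasDerivAt_id r).smul_const (radialUnit θ)

theorem ContDiffOn.hasFDerivAt_ball {F : Type*} [NormedAddCommGroup F] [NormedSpace ℝ F]
    {f : Plane → F} (hf : ContDiffOn ℝ 1 f (ball 0 1)) {x : Plane} (hx : x ∈ ball (0 : Plane) 1) :
    HasFDerivAt f (fderiv ℝ f x) x :=
  ((hf.contDiffAt (isOpen_ball.mem_nhds hx)).differentiableAt (by norm_num)).hasFDerivAt

theorem hasDerivAt_angularComponent (hg : Continuous g) (hv : ContDiffOn ℝ 1 v (ball 0 1)) {r : ℝ}
    (hr : r ∈ Set.Ioo (-1 : ℝ) 1) :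
    HasDerivAt (angularComponent g v) (angularComponentDeriv g v r) r := by
  have hgc : Continuous fun p : ℝ × ℝ => g p.2 := hg.comp continuous_snd
  have hrc : Continuous fun p : ℝ × ℝ => radialUnit p.2 := continuous_radialUnit.comp continuous_snd
  refine hasDerivAt_intervalIntegral_of_continuousOn isOpen_Ioo
    (F := fun r θ => g θ * v (r • radialUnit θ))
    (F' := fun r θ => g θ * fderiv ℝ v (r • radialUnit θ) (radialUnit θ)) ?_ ?_ ?_ 0 (2 * Real.pi) hr
  · exact hgc.continuousOn.mul hv.continuousOn.comp_polar
  · exact hgc.continuousOn.mul (hv.continuousOn_fderiv_ball.comp_polar.clm_apply hrc.continuousOn)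
  · intro s hs θ
    exact ((hv.hasFDerivAt_ball (smul_radialUnit_mem_ball hs θ)).comp_hasDerivAt s
      (hasDerivAt_smul_radialUnit s θ)).const_mul (g θ)

theorem hasDerivAt_angularComponentDeriv (hg : Continuous g) (hv : ContDiffOn ℝ 2 v (ball 0 1))
    {r : ℝ} (hr : r ∈ Set.Ioo (-1 : ℝ) 1) :
    HasDerivAt (angularComponentDeriv g v) (angularComponentDerivTwo g v r) r := by
  have hgc : Continuous fun p : ℝ × ℝ => g p.2 := hg.comp continuous_snd
  have hrc : Continuous fun p : ℝ × ℝ => radialUnit p.2 := continuous_radialUnit.comp continuous_snd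
  have hv1 := hv.contDiffOn_fderiv_ball
  have hv2 : ContinuousOn (fderiv ℝ (fderiv ℝ v)) (ball 0 1) :=
    hv1.continuousOn_fderiv_of_isOpen isOpen_ball le_rfl
  refine hasDerivAt_intervalIntegral_of_continuousOn isOpen_Ioo
    (F := fun r θ => g θ * fderiv ℝ v (r • radialUnit θ) (radialUnit θ))
    (F' := fun r θ =>
      g θ * fderiv ℝ (fderiv ℝ v) (r • radialUnit θ) (radialUnit θ) (radialUnit θ))
    ?_ ?_ ?_ 0 (2 * Real.pi) hr
  · exact hgc.continuousOn.mul (hv1.continuousOn.comp_polar.clm_apply hrc.continuousOn)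
  · exact hgc.continuousOn.mul
      ((hv2.comp_polar.clm_apply hrc.continuousOn).clm_apply hrc.continuousOn)
  · intro s hs θ
    have h := (hv1.hasFDerivAt_ball (smul_radialUnit_mem_ball hs θ)).comp_hasDerivAt s
      (hasDerivAt_smul_radialUnit s θ)
    have h' := h.clm_apply (hasDerivAt_const s (radialUnit θ))
    simp only [map_zero, add_zero] at h'
    exact h'.const_mul (g θ)

/-- Two integrations by parts over the circle. -/
theorem IsAngularMode.integral_mul_deriv_deriv (hg : IsAngularMode k g g') {V V' V'' : ℝ → ℝ}
    (hV : ∀ θ, HasDerivAt V (V' θ) θ) (hV' : ∀ θ, HasDerivAt V' (V'' θ) θ) (hV'' : Continuous V'')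
    (hp : V (2 * Real.pi) = V 0) (hp' : V' (2 * Real.pi) = V' 0) :
    ∫ θ in (0 : ℝ)..(2 * Real.pi), g θ * V'' θ =
      -(k : ℝ) ^ 2 * ∫ θ in (0 : ℝ)..(2 * Real.pi), g θ * V θ := by
  have hVc : Continuous V' := continuous_iff_continuousAt.2 fun θ => (hV' θ).continuousAt
  rw [intervalIntegral.integral_mul_deriv_eq_deriv_mul (fun θ _ => hg.deriv_eq θ)
      (fun θ _ => hV' θ) (hg.continuous_deriv.intervalIntegrable _ _)
      (hV''.intervalIntegrable _ _), hp', hg.periodic, sub_self, zero_sub,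
    intervalIntegral.integral_mul_deriv_eq_deriv_mul (fun θ _ => hg.deriv_deriv_eq θ)
      (fun θ _ => hV θ) ((continuous_const.mul hg.continuous).intervalIntegrable _ _)
      (hVc.intervalIntegrable _ _), hp, hg.periodic_deriv, sub_self, zero_sub, neg_neg,
    ← intervalIntegral.integral_const_mul]
  simp only [mul_assoc]

theorem clm_apply_smul_smul {E : Type*} [NormedAddCommGroup E] [NormedSpace ℝ E]
    (D : E →L[ℝ] E →L[ℝ] ℝ) (r : ℝ) (a : E) : D (r • a) (r • a) = r ^ 2 * D a a := by
  rw [ContinuousLinearMap.map_smul, ContinuousLinearMap.map_smul, smul_apply,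
    smul_eq_mul, smul_eq_mul]
  ring

/-- The second `θ`-derivative of `v` along the circle is `r² v_tt - r v_r`, with `v_tt` the
tangential second derivative. The equation `Δv = μv` rewrites this by radial derivatives, and
integrating by parts twice against `g` produces `-k²`. Negative `r` are admitted so that `r = 0` is
an interior point. -/
theorem angularComponent_ode (hg : IsAngularMode k g g') (hv : ContDiffOn ℝ 2 v (ball 0 1)) {μ : ℝ}
    (hΔ : ∀ x ∈ ball (0 : Plane) 1, Δ v x = μ * v x) {r : ℝ} (hr : r ∈ Set.Ioo (-1 : ℝ) 1) :
    r ^ 2 * angularComponentDerivTwo g v r + r * angularComponentDeriv g v r =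
      (μ * r ^ 2 + (k : ℝ) ^ 2) * angularComponent g v r := by
  have hv0 : ContDiffOn ℝ 1 v (ball 0 1) := hv.of_le (by norm_num)
  have hv1 := hv.contDiffOn_fderiv_ball
  have hv2 : ContinuousOn (fderiv ℝ (fderiv ℝ v)) (ball 0 1) :=
    hv1.continuousOn_fderiv_of_isOpen isOpen_ball le_rfl
  have hmem : ∀ θ, r • radialUnit θ ∈ ball (0 : Plane) 1 := smul_radialUnit_mem_ball hr
  have hcurve : ∀ θ, HasDerivAt (fun θ => r • radialUnit θ) (r • tangentialUnit θ) θ :=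
    fun θ => (hasDerivAt_radialUnit θ).const_smul r
  have hV : ∀ θ, HasDerivAt (fun θ => v (r • radialUnit θ))
      (fderiv ℝ v (r • radialUnit θ) (r • tangentialUnit θ)) θ := fun θ =>
    (hv0.hasFDerivAt_ball (hmem θ)).comp_hasDerivAt θ (hcurve θ)
  have hV' : ∀ θ, HasDerivAt (fun θ => fderiv ℝ v (r • radialUnit θ) (r • tangentialUnit θ))
      (fderiv ℝ (fderiv ℝ v) (r • radialUnit θ) (r • tangentialUnit θ) (r • tangentialUnit θ) +
        fderiv ℝ v (r • radialUnit θ) (r • -radialUnit θ)) θ := by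
    intro θ
    have h1 : HasDerivAt (fun θ => fderiv ℝ v (r • radialUnit θ))
        (fderiv ℝ (fderiv ℝ v) (r • radialUnit θ) (r • tangentialUnit θ)) θ :=
      (hv1.hasFDerivAt_ball (hmem θ)).comp_hasDerivAt θ (hcurve θ)
    have h2 : HasDerivAt (fun θ => r • tangentialUnit θ) (r • -radialUnit θ) θ :=
      (hasDerivAt_tangentialUnit θ).const_smul r
    exact h1.clm_apply h2
  have hpc : Continuous fun θ => r • radialUnit θ := continuous_radialUnit.const_smul r
  have htc : Continuous fun θ => r • tangentialUnit θ := continuous_tangentialUnit.const_smul r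
  have hD0 : Continuous fun θ => v (r • radialUnit θ) :=
    hv.continuousOn.comp_continuous hpc hmem
  have hD1 : Continuous fun θ => fderiv ℝ v (r • radialUnit θ) :=
    hv1.continuousOn.comp_continuous hpc hmem
  have hD2 : Continuous fun θ => fderiv ℝ (fderiv ℝ v) (r • radialUnit θ) :=
    hv2.comp_continuous hpc hmem
  have hper : radialUnit (2 * Real.pi) = radialUnit 0 := by simp [radialUnit]
  have hper' : tangentialUnit (2 * Real.pi) = tangentialUnit 0 := by simp [tangentialUnit]
  have hparts := hg.integral_mul_deriv_deriv hV hV'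
    (((hD2.clm_apply htc).clm_apply htc).add
      (hD1.clm_apply (continuous_radialUnit.neg.const_smul r)))
    (by simp only [hper]) (by simp only [hper, hper'])
  have hgc := hg.continuous
  have i0 : IntervalIntegrable (fun θ => g θ * v (r • radialUnit θ)) MeasureTheory.volume 0
    (2 * Real.pi) := (hgc.mul hD0).intervalIntegrable _ _
  have i1 : IntervalIntegrable (fun θ => g θ * fderiv ℝ v (r • radialUnit θ) (radialUnit θ))
      MeasureTheory.volume 0 (2 * Real.pi) :=
    (hgc.mul (hD1.clm_apply continuous_radialUnit)).intervalIntegrable _ _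
  have i2 : IntervalIntegrable (fun θ => g θ *
      fderiv ℝ (fderiv ℝ v) (r • radialUnit θ) (radialUnit θ) (radialUnit θ))
      MeasureTheory.volume 0 (2 * Real.pi) :=
    (hgc.mul ((hD2.clm_apply continuous_radialUnit).clm_apply
      continuous_radialUnit)).intervalIntegrable _ _
  have hcongr : (fun θ => g θ *
      (fderiv ℝ (fderiv ℝ v) (r • radialUnit θ) (r • tangentialUnit θ) (r • tangentialUnit θ) +
        fderiv ℝ v (r • radialUnit θ) (r • -radialUnit θ))) = fun θ =>
      (μ * r ^ 2) * (g θ * v (r • radialUnit θ)) - (r ^ 2 * (g θ *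
        fderiv ℝ (fderiv ℝ v) (r • radialUnit θ) (radialUnit θ) (radialUnit θ)) +
        r * (g θ * fderiv ℝ v (r • radialUnit θ) (radialUnit θ))) := by
    funext θ
    have h := hΔ _ (hmem θ)
    rw [laplacian_eq_fderiv_fderiv v _ θ] at h
    rw [clm_apply_smul_smul, ContinuousLinearMap.map_smul,
      ContinuousLinearMap.map_neg, smul_eq_mul]
    linear_combination r ^ 2 * g θ * h
  rw [hcongr, intervalIntegral.integral_sub (i0.const_mul _)
      ((i2.const_mul _).add (i1.const_mul _)),
    intervalIntegral.integral_add (i2.const_mul _) (i1.const_mul _),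
    intervalIntegral.integral_const_mul, intervalIntegral.integral_const_mul,
    intervalIntegral.integral_const_mul] at hparts
  rw [angularComponentDerivTwo, angularComponentDeriv, angularComponent]
  linarith

end

/-! ### The radial equation `r² y'' + r y' = (μ r² + k²) y` -/

/-- The solution `rᵏ ∑ (μ r² / 4)ᵐ / (m! (m + k)!)`, regular at `0`, of
`r² y'' + r y' = (μ r² + k²) y`. -/
noncomputable def radialSolution (k : ℕ) (μ r : ℝ) : ℝ := r ^ k * besselSeries k (μ * r ^ 2 / 4)

/-- The function `r y'(r)` for `y = radialSolution k μ`. -/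
noncomputable def radialSolutionEuler (k : ℕ) (μ r : ℝ) : ℝ :=
  k * radialSolution k μ r + μ / 2 * (r ^ (k + 2) * besselSeries (k + 1) (μ * r ^ 2 / 4))

theorem hasDerivAt_besselSeries_comp (k : ℕ) (μ r : ℝ) :
    HasDerivAt (fun r => besselSeries k (μ * r ^ 2 / 4))
      (besselSeries (k + 1) (μ * r ^ 2 / 4) * (μ * r / 2)) r := by
  have h : HasDerivAt (fun r : ℝ => μ * r ^ 2 / 4) (μ * r / 2) r := by
    refine (((hasDerivAt_pow 2 r).const_mul μ).div_const 4).congr_deriv ?_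
    push_cast
    ring
  exact (hasDerivAt_besselSeries k (μ * r ^ 2 / 4)).comp r h

theorem hasDerivAt_radialSolution (k : ℕ) (μ : ℝ) {r : ℝ} (hr : r ≠ 0) :
    HasDerivAt (radialSolution k μ) (radialSolutionEuler k μ r / r) r := by
  refine ((hasDerivAt_pow k r).mul (hasDerivAt_besselSeries_comp k μ r)).congr_deriv ?_
  rw [eq_div_iff hr, radialSolutionEuler, radialSolution]
  rcases k with _ | k
  · simp; ring
  · simp only [Nat.add_sub_cancel]
    push_cast
    ring

/-- The radial equation in divergence form, `(r y')' = (μ r² + k²) y / r`. -/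
theorem hasDerivAt_radialSolutionEuler (k : ℕ) (μ : ℝ) {r : ℝ} (hr : r ≠ 0) :
    HasDerivAt (radialSolutionEuler k μ) ((μ * r ^ 2 + (k : ℝ) ^ 2) * radialSolution k μ r / r)
      r := by
  refine (((hasDerivAt_radialSolution k μ hr).const_mul (k : ℝ)).add (((hasDerivAt_pow (k + 2) r).mul
    (hasDerivAt_besselSeries_comp (k + 1) μ r)).const_mul (μ / 2))).congr_deriv ?_
  rw [eq_div_iff hr, radialSolutionEuler, radialSolution,
    ← besselSeries_recurrence k (μ * r ^ 2 / 4)]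
  have h1 : k + 2 - 1 = k + 1 := rfl
  rw [h1]
  push_cast
  field_simp
  ring

theorem continuous_radialSolution (k : ℕ) (μ : ℝ) : Continuous (radialSolution k μ) :=
  (continuous_pow k).mul ((continuous_besselSeries k).comp (by fun_prop))

theorem continuous_radialSolutionEuler (k : ℕ) (μ : ℝ) : Continuous (radialSolutionEuler k μ) :=
  ((continuous_radialSolution k μ).const_mul _).add (((continuous_pow (k + 2)).mul
    ((continuous_besselSeries (k + 1)).comp (by fun_prop))).const_mul _)

theorem radialSolutionEuler_zero (k : ℕ) (μ : ℝ) : radialSolutionEuler k μ 0 = 0 := by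
  rcases k with _ | k <;> simp [radialSolutionEuler, radialSolution]

/-- A solution on `(-1, 1)` of `r² y'' + r y' = (μ r² + k²) y`. -/
structure IsRadialSolution (k : ℕ) (μ : ℝ) (y y' y'' : ℝ → ℝ) : Prop where
  deriv_eq : ∀ r ∈ Set.Ioo (-1 : ℝ) 1, HasDerivAt y (y' r) r
  deriv_deriv_eq : ∀ r ∈ Set.Ioo (-1 : ℝ) 1, HasDerivAt y' (y'' r) r
  ode : ∀ r ∈ Set.Ioo (-1 : ℝ) 1, r ^ 2 * y'' r + r * y' r = (μ * r ^ 2 + (k : ℝ) ^ 2) * y r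

theorem Set.Ioo_zero_one_subset : Set.Ioo (0 : ℝ) 1 ⊆ Set.Ioo (-1 : ℝ) 1 :=
  Set.Ioo_subset_Ioo_left (by norm_num)

namespace IsRadialSolution

variable {k : ℕ} {μ : ℝ} {y y' y'' : ℝ → ℝ}

/-- The Wronskian multiplied by `r` is constant, and it vanishes at `0` because `y` and `y'` are
finite there. This rules out the singular solution without constructing it. -/
theorem wronskian_eq_zero (h : IsRadialSolution k μ y y' y'') {r : ℝ} (hr : r ∈ Set.Ioo (0 : ℝ) 1) :
    r * y' r * radialSolution k μ r - y r * radialSolutionEuler k μ r = 0 := by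
  set W : ℝ → ℝ := fun r => r * y' r * radialSolution k μ r - y r * radialSolutionEuler k μ r
  have hW0 : W 0 = 0 := by simp [W, radialSolutionEuler_zero]
  have hsub : Set.Icc 0 r ⊆ Set.Ioo (-1 : ℝ) 1 := fun x hx =>
    ⟨by linarith [hx.1], hx.2.trans_lt hr.2⟩
  have hcont : ContinuousOn W (Set.Icc 0 r) := by
    have c1 : ContinuousOn y' (Set.Icc 0 r) := fun x hx =>
      (h.deriv_deriv_eq x (hsub hx)).continuousAt.continuousWithinAt
    have c0 : ContinuousOn y (Set.Icc 0 r) := fun x hx =>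
      (h.deriv_eq x (hsub hx)).continuousAt.continuousWithinAt
    exact ((continuousOn_id.mul c1).mul (continuous_radialSolution k μ).continuousOn).sub
      (c0.mul (continuous_radialSolutionEuler k μ).continuousOn)
  have hderiv : ∀ x ∈ Set.Ioo 0 r, HasDerivAt W 0 x := by
    intro x hx
    have hx' := hsub ⟨hx.1.le, hx.2.le⟩
    have hx0 : x ≠ 0 := hx.1.ne'
    refine ((((hasDerivAt_id' x).mul (h.deriv_deriv_eq x hx')).mul
      (hasDerivAt_radialSolution k μ hx0)).sub ((h.deriv_eq x hx').mul
      (hasDerivAt_radialSolutionEuler k μ hx0))).congr_deriv ?_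
    have := h.ode x hx'
    simp only [Pi.mul_apply]
    field_simp
    linear_combination radialSolution k μ x * this
  obtain ⟨c, hc, hslope⟩ := exists_hasDerivAt_eq_slope W (fun _ => 0) hr.1 hcont hderiv
  rw [hW0, sub_zero, eq_comm, div_eq_zero_iff] at hslope
  exact hslope.resolve_right (by linarith [hr.1])

/-- The quotient by the regular solution has derivative zero. The regular solution must have no zero
in `(0, 1)`, which holds for `μ = β²`, and for `μ = -α²` when `k ≥ 1` and `α < j_{1,1}`. -/
theorem eq_const_mul (h : IsRadialSolution k μ y y' y'')
    (hpos : ∀ r ∈ Set.Ioo (0 : ℝ) 1, 0 < besselSeries k (μ * r ^ 2 / 4)) :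
    ∃ c, ∀ r ∈ Set.Ioo (0 : ℝ) 1, y r = c * radialSolution k μ r := by
  have hP : ∀ r ∈ Set.Ioo (0 : ℝ) 1, 0 < radialSolution k μ r := fun r hr =>
    mul_pos (pow_pos hr.1 k) (hpos r hr)
  have hd : ∀ r ∈ Set.Ioo (0 : ℝ) 1, HasDerivAt (fun r => y r / radialSolution k μ r) 0 r := by
    intro r hr
    refine ((h.deriv_eq r (Set.Ioo_zero_one_subset hr)).div
      (hasDerivAt_radialSolution k μ hr.1.ne') (hP r hr).ne').congr_deriv ?_
    have hw := h.wronskian_eq_zero hr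
    have h0 := hr.1.ne'
    rw [div_eq_zero_iff]
    left
    field_simp
    linarith
  refine ⟨y (1 / 2) / radialSolution k μ (1 / 2), fun r hr => ?_⟩
  have hh : (1 / 2 : ℝ) ∈ Set.Ioo (0 : ℝ) 1 := by norm_num
  have := isOpen_Ioo.is_const_of_deriv_eq_zero (convex_Ioo 0 1).isPreconnected
    (fun x hx => (hd x hx).differentiableAt.differentiableWithinAt)
    (fun x hx => (hd x hx).deriv) hr hh
  rw [← this, div_mul_cancel₀ _ (hP r hr).ne']

/-- Dividing the differential equation by `r` would require control of `y''` near `0`; the Wronskian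
identity needs only continuity of `y` and `y'` there. -/
theorem deriv_zero (h : IsRadialSolution 0 μ y y' y'') : y' 0 = 0 := by
  have h0 : (0 : ℝ) ∈ Set.Ioo (-1 : ℝ) 1 := by norm_num
  have e : ∀ r ∈ Set.Ioo (0 : ℝ) 1, y' r * radialSolution 0 μ r =
      y r * (μ / 2 * (r * besselSeries 1 (μ * r ^ 2 / 4))) := by
    intro r hr
    have hw := h.wronskian_eq_zero hr
    have hr0 := hr.1.ne'
    refine mul_left_cancel₀ hr0 ?_
    simp only [radialSolutionEuler, CharP.cast_eq_zero, zero_mul, zero_add] at hw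
    linarith
  have t1 : Tendsto (fun r => y' r * radialSolution 0 μ r) (𝓝[>] 0) (𝓝 (y' 0)) := by
    have : Tendsto (fun r => y' r * radialSolution 0 μ r) (𝓝[>] 0)
        (𝓝 (y' 0 * radialSolution 0 μ 0)) := ((h.deriv_deriv_eq 0 h0).continuousAt.mul (continuous_radialSolution 0 μ).continuousAt
      ).tendsto.mono_left (nhdsWithin_le_nhds (s := Set.Ioi 0))
    simpa [radialSolution, besselSeries_zero_arg] using this
  have t2 : Tendsto (fun r => y r * (μ / 2 * (r * besselSeries 1 (μ * r ^ 2 / 4)))) (𝓝[>] 0)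
      (𝓝 0) := by
    have c2 : Continuous fun r : ℝ => μ / 2 * (r * besselSeries 1 (μ * r ^ 2 / 4)) :=
      continuous_const.mul (continuous_id.mul ((continuous_besselSeries 1).comp (by fun_prop)))
    have : Tendsto (fun r => y r * (μ / 2 * (r * besselSeries 1 (μ * r ^ 2 / 4)))) (𝓝[>] 0)
        (𝓝 (y 0 * (μ / 2 * (0 * besselSeries 1 (μ * 0 ^ 2 / 4))))) :=
      ((h.deriv_eq 0 h0).continuousAt.mul c2.continuousAt).tendsto.mono_left
      (nhdsWithin_le_nhds (s := Set.Ioi 0))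
    simpa using this
  refine tendsto_nhds_unique (t1.congr' ?_) t2
  filter_upwards [Ioo_mem_nhdsGT (zero_lt_one : (0 : ℝ) < 1)] with r hr using e r hr

/-- An energy argument. -/
theorem eq_zero_of_zero (h : IsRadialSolution 0 μ y y' y'') (hμ : μ < 0) (h0 : y 0 = 0) {r : ℝ}
    (hr : r ∈ Set.Ioo (0 : ℝ) 1) : y r = 0 := by
  have hsub : Set.Icc 0 r ⊆ Set.Ioo (-1 : ℝ) 1 := fun x hx =>
    ⟨by linarith [hx.1], hx.2.trans_lt hr.2⟩
  -- The energy `y'² - μ y²` is nonnegative as `μ < 0`, vanishes at `0`, and has derivative `-2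
  -- y'²/x` for `x > 0`.
  have hE : ∀ x ∈ Set.Ioo (-1 : ℝ) 1, HasDerivAt (fun x => y' x ^ 2 - μ * y x ^ 2)
      (2 * y' x * (y'' x - μ * y x)) x := by
    intro x hx
    refine (((h.deriv_deriv_eq x hx).pow 2).sub (((h.deriv_eq x hx).pow 2).const_mul μ)).congr_deriv ?_
    push_cast
    ring
  have hanti : AntitoneOn (fun x => y' x ^ 2 - μ * y x ^ 2) (Set.Icc 0 r) := by
    refine antitoneOn_of_deriv_nonpos (convex_Icc 0 r)
      (fun x hx => (hE x (hsub hx)).continuousAt.continuousWithinAt)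
      (fun x hx => ?_) (fun x hx => ?_) <;> rw [interior_Icc] at hx
    · exact (hE x (hsub ⟨hx.1.le, hx.2.le⟩)).differentiableAt.differentiableWithinAt
    · have hx' := hsub ⟨hx.1.le, hx.2.le⟩
      rw [(hE x hx').deriv]
      have hode := h.ode x hx'
      have : x * (y'' x - μ * y x) = -y' x := by
        refine mul_left_cancel₀ hx.1.ne' ?_
        simp only [CharP.cast_eq_zero] at hode
        linarith
      have h2 : x * (2 * y' x * (y'' x - μ * y x)) ≤ 0 := by
        rw [show x * (2 * y' x * (y'' x - μ * y x)) = -(2 * y' x ^ 2) by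
          linear_combination 2 * y' x * this]
        linarith [sq_nonneg (y' x)]
      exact nonpos_of_mul_nonpos_right h2 hx.1
  have := hanti ⟨le_rfl, hr.1.le⟩ ⟨hr.1.le, le_rfl⟩ hr.1.le
  simp only [h.deriv_zero, h0] at this
  have h3 : y r ^ 2 ≤ 0 := by nlinarith [sq_nonneg (y' r), sq_nonneg (y r)]
  exact pow_eq_zero_iff (two_ne_zero) |>.1 (le_antisymm h3 (sq_nonneg _))

end IsRadialSolution

theorem isRadialSolution_radialSolution_zero (μ : ℝ) :
    IsRadialSolution 0 μ (radialSolution 0 μ)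
      (fun r => besselSeries 1 (μ * r ^ 2 / 4) * (μ * r / 2))
      (fun r => besselSeries 2 (μ * r ^ 2 / 4) * (μ * r / 2) * (μ * r / 2) +
        besselSeries 1 (μ * r ^ 2 / 4) * (μ / 2)) where
  deriv_eq r _ := by
    have := hasDerivAt_besselSeries_comp 0 μ r
    rwa [show radialSolution 0 μ = fun r => besselSeries 0 (μ * r ^ 2 / 4) by
      funext r; simp [radialSolution]]
  deriv_deriv_eq r _ :=
    (hasDerivAt_besselSeries_comp 1 μ r).mul
      (((hasDerivAt_id' r).const_mul μ).div_const 2 |>.congr_deriv (by ring))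
  ode r _ := by
    rw [radialSolution, ← besselSeries_recurrence 0]
    push_cast
    ring

/-- Division by `J_0(αr)` is unavailable, since `J_0` changes sign before `α_{0,1}`. Instead the
energy argument is applied to `y - y(0) J_0(αr)`. -/
theorem IsRadialSolution.eq_const_mul_of_neg {μ : ℝ} {y y' y'' : ℝ → ℝ}
    (h : IsRadialSolution 0 μ y y' y'') (hμ : μ < 0) :
    ∃ c, ∀ r ∈ Set.Ioo (0 : ℝ) 1, y r = c * radialSolution 0 μ r := by
  refine ⟨y 0, fun r hr => ?_⟩
  have hP := isRadialSolution_radialSolution_zero μ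
  have hd : IsRadialSolution 0 μ (fun r => y r - y 0 * radialSolution 0 μ r) _ _ :=
    { deriv_eq := fun r hr => (h.deriv_eq r hr).sub ((hP.deriv_eq r hr).const_mul (y 0))
      deriv_deriv_eq := fun r hr =>
        (h.deriv_deriv_eq r hr).sub ((hP.deriv_deriv_eq r hr).const_mul (y 0))
      ode := fun r hr => by linear_combination h.ode r hr - y 0 * hP.ode r hr }
  have := hd.eq_zero_of_zero hμ (by simp [radialSolution, besselSeries_zero_arg]) hr
  linarith

theorem Set.EqOn.Icc_of_Ioo {f h : ℝ → ℝ} (hf : ContinuousOn f (Set.Icc 0 1))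
    (hh : ContinuousOn h (Set.Icc 0 1)) (heq : ∀ r ∈ Set.Ioo (0 : ℝ) 1, f r = h r) :
    Set.EqOn f h (Set.Icc 0 1) := by
  refine Set.EqOn.of_subset_closure (s := Set.Ioo 0 1) heq hf hh Set.Ioo_subset_Icc_self ?_
  rw [closure_Ioo (by norm_num)]

/-! ### Vanishing Fourier modes -/

theorem eq_average_of_fourier_modes_eq_zero {f : ℝ → ℝ} (hf : Continuous f)
    (hper : Function.Periodic f (2 * Real.pi))
    (hcos : ∀ k : ℕ, 1 ≤ k → ∫ θ in (0 : ℝ)..(2 * Real.pi), Real.cos (k * θ) * f θ = 0)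
    (hsin : ∀ k : ℕ, 1 ≤ k → ∫ θ in (0 : ℝ)..(2 * Real.pi), Real.sin (k * θ) * f θ = 0) (θ : ℝ) :
    f θ = (1 / (2 * Real.pi)) * ∫ θ in (0 : ℝ)..(2 * Real.pi), f θ := by
  have : Fact (0 < 2 * Real.pi) := ⟨Real.two_pi_pos⟩
  have hperC : Function.Periodic (fun θ => (f θ : ℂ)) (2 * Real.pi) := fun θ => by
    simp only [hper θ]
  have hFc : Continuous hperC.lift :=
    continuous_coinduced_dom.2 (Complex.continuous_ofReal.comp hf)
  set F : C(AddCircle (2 * Real.pi), ℂ) := ⟨hperC.lift, hFc⟩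
  have hcoeff : ∀ n : ℤ, n ≠ 0 → fourierCoeff F n = 0 := by
    intro n hn
    rw [fourierCoeff_eq_intervalIntegral _ _ 0, zero_add]
    have e : ∀ θ : ℝ, fourier (-n) (θ : AddCircle (2 * Real.pi)) • F θ =
        ((Real.cos (n * θ) * f θ : ℝ) : ℂ) - ((Real.sin (n * θ) * f θ : ℝ) : ℂ) * Complex.I := by
      intro θ
      have : F θ = (f θ : ℂ) := rfl
      rw [this, fourier_coe_apply, smul_eq_mul]
      have harg : 2 * (Real.pi : ℂ) * Complex.I * ((-n : ℤ) : ℂ) * (θ : ℂ) /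
          ((2 * Real.pi : ℝ) : ℂ) = ((-(n * θ) : ℝ) : ℂ) * Complex.I := by
        have : (Real.pi : ℂ) ≠ 0 := by exact_mod_cast Real.pi_ne_zero
        push_cast
        field_simp
      rw [harg, Complex.exp_mul_I, ← Complex.ofReal_cos, ← Complex.ofReal_sin, Real.cos_neg,
        Real.sin_neg]
      push_cast
      ring
    have hk : 1 ≤ n.natAbs := Int.natAbs_pos.2 hn
    have hc : ∫ θ in (0 : ℝ)..(2 * Real.pi), Real.cos (n * θ) * f θ = 0 := by
      have := hcos _ hk
      rcases Int.natAbs_eq n with h | h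
      · rw [h]; simpa using this
      · rw [h]; simpa using this
    have hs : ∫ θ in (0 : ℝ)..(2 * Real.pi), Real.sin (n * θ) * f θ = 0 := by
      have := hsin _ hk
      rcases Int.natAbs_eq n with h | h
      · rw [h]; simpa using this
      · rw [h]; simpa using this
    have ic : Continuous fun θ : ℝ => Real.cos (n * θ) * f θ := by fun_prop
    have is : Continuous fun θ : ℝ => Real.sin (n * θ) * f θ := by fun_prop
    simp_rw [e]
    have jc : IntervalIntegrable (fun θ : ℝ => ((Real.cos (n * θ) * f θ : ℝ) : ℂ))
        MeasureTheory.volume 0 (2 * Real.pi) :=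
      (Complex.continuous_ofReal.comp ic).intervalIntegrable _ _
    have js : IntervalIntegrable (fun θ : ℝ => ((Real.sin (n * θ) * f θ : ℝ) : ℂ))
        MeasureTheory.volume 0 (2 * Real.pi) :=
      (Complex.continuous_ofReal.comp is).intervalIntegrable _ _
    rw [intervalIntegral.integral_sub jc (js.mul_const _),
      intervalIntegral.integral_mul_const, intervalIntegral.integral_ofReal,
      intervalIntegral.integral_ofReal, hc, hs]
    simp
  -- With a single possibly nonzero coefficient the Fourier series is summable, so it converges
  -- pointwise to the continuous function.
  have hsum : Summable (fourierCoeff F) :=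
    summable_of_ne_finset_zero (s := {0}) fun n hn => hcoeff n (by simpa using hn)
  have h1 := has_pointwise_sum_fourier_series_of_summable hsum (θ : AddCircle (2 * Real.pi))
  have h2 := hasSum_single (f := fun i => fourierCoeff F i • fourier i
    (θ : AddCircle (2 * Real.pi))) 0 (fun n hn => by simp [hcoeff n hn])
  have h3 := h1.unique h2
  have h4 : F θ = (f θ : ℂ) := rfl
  rw [h4, fourierCoeff_eq_intervalIntegral _ _ 0, zero_add] at h3
  have h5 : ∀ x : ℝ, fourier (-0) (x : AddCircle (2 * Real.pi)) • F x = (f x : ℂ) := by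
    intro x
    have : F x = (f x : ℂ) := rfl
    simp [this]
  simp_rw [h5] at h3
  rw [intervalIntegral.integral_ofReal] at h3
  simp only [fourier_zero, smul_eq_mul, mul_one, Complex.real_smul] at h3
  exact_mod_cast h3

/-! ### Clamped solutions with values in `ℝ` -/

/-- Real-valued solutions of the boundary value problem, the zero function included. -/
structure IsClampedSolution (κ lam : ℝ) (u : Plane → ℝ) : Prop where
  contDiffOn_ball : ContDiffOn ℝ 4 u (ball 0 1)
  contDiffOn_closedBall : ContDiffOn ℝ 1 u (closedBall 0 1)
  equation : ∀ x ∈ ball (0 : Plane) 1, Δ (Δ u) x - κ ^ 2 * u x = -(lam * Δ u x)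
  boundary_value : ∀ x ∈ sphere (0 : Plane) 1, u x = 0
  boundary_deriv : ∀ x ∈ sphere (0 : Plane) 1, fderivWithin ℝ u (closedBall 0 1) x x = 0

theorem ContDiffOn.laplacian_ball {F : Type*} [NormedAddCommGroup F] [NormedSpace ℝ F]
    {u : Plane → F} (hu : ContDiffOn ℝ 4 u (ball 0 1)) :
    ContDiffOn ℝ 2 (Δ u) (ball 0 1) := by
  have h1 : ContDiffOn ℝ 3 (fderiv ℝ u) (ball 0 1) := hu.fderiv_of_isOpen isOpen_ball (by norm_num)
  have h2 : ContDiffOn ℝ 2 (fderiv ℝ (fderiv ℝ u)) (ball 0 1) :=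
    h1.fderiv_of_isOpen isOpen_ball (by norm_num)
  refine ContDiffOn.congr ?_ fun x _ => laplacian_eq_fderiv_fderiv u x 0
  exact ((h2.clm_apply contDiffOn_const).clm_apply contDiffOn_const).add
    ((h2.clm_apply contDiffOn_const).clm_apply contDiffOn_const)

theorem uniqueDiffOn_closedBall : UniqueDiffOn ℝ (closedBall (0 : Plane) 1) :=
  uniqueDiffOn_convex (convex_closedBall _ _) (by
    rw [interior_closedBall _ one_ne_zero]
    exact ⟨0, by simp⟩)

theorem fderivWithin_closedBall {F : Type*} [NormedAddCommGroup F] [NormedSpace ℝ F]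
    (u : Plane → F) {x : Plane} (hx : x ∈ ball (0 : Plane) 1) :
    fderivWithin ℝ u (closedBall 0 1) x = fderiv ℝ u x :=
  fderivWithin_of_mem_nhds (mem_of_superset (isOpen_ball.mem_nhds hx) ball_subset_closedBall)

theorem radialUnit_mem_sphere (θ : ℝ) : radialUnit θ ∈ sphere (0 : Plane) 1 := by
  simp [norm_radialUnit]

theorem ContinuousOn.comp_polar_closed {F : Type*} [TopologicalSpace F] {f : Plane → F}
    (hf : ContinuousOn f (closedBall 0 1)) :
    ContinuousOn (fun p : ℝ × ℝ => f (p.1 • radialUnit p.2)) (Set.Icc 0 1 ×ˢ Set.univ) :=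
  hf.comp continuous_smul_radialUnit.continuousOn fun p hp =>
    smul_radialUnit_mem_closedBall hp.1 p.2

theorem isRadialSolution_angularComponent {k : ℕ} {g g' : ℝ → ℝ} (hg : IsAngularMode k g g')
    {v : Plane → ℝ} (hv : ContDiffOn ℝ 2 v (ball 0 1)) {μ : ℝ}
    (hΔ : ∀ x ∈ ball (0 : Plane) 1, Δ v x = μ * v x) :
    IsRadialSolution k μ (angularComponent g v) (angularComponentDeriv g v)
      (angularComponentDerivTwo g v) where
  deriv_eq _ hr := hasDerivAt_angularComponent hg.continuous (hv.of_le (by norm_num)) hr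
  deriv_deriv_eq _ hr := hasDerivAt_angularComponentDeriv hg.continuous hv hr
  ode _ hr := angularComponent_ode hg hv hΔ hr

namespace IsClampedSolution

variable {κ lam α β : ℝ} {u : Plane → ℝ}

theorem laplacian_add_smul (hu : IsClampedSolution κ lam u) (c : ℝ) {x : Plane}
    (hx : x ∈ ball (0 : Plane) 1) :
    Δ (Δ u + c • u) x = κ ^ 2 * u x + (c - lam) * Δ u x := by
  have hu2 : ContDiffAt ℝ 2 u x :=
    (hu.contDiffOn_ball.contDiffAt (isOpen_ball.mem_nhds hx)).of_le (by norm_num)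
  have hΔ : ContDiffAt ℝ 2 (Δ u) x :=
    hu.contDiffOn_ball.laplacian_ball.contDiffAt (isOpen_ball.mem_nhds hx)
  have hc : ContDiffAt ℝ 2 (c • u) x := hu2.const_smul c
  rw [hΔ.laplacian_add hc, InnerProductSpace.laplacian_smul c hu2, smul_eq_mul]
  linarith [hu.equation x hx]

theorem contDiffOn_laplacian_add_smul (hu : IsClampedSolution κ lam u) (c : ℝ) :
    ContDiffOn ℝ 2 (Δ u + c • u) (ball 0 1) :=
  hu.contDiffOn_ball.laplacian_ball.add
    ((hu.contDiffOn_ball.of_le (by norm_num)).const_smul c)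

/-- On the open disc, `u` is a combination of solutions of two Helmholtz equations; hence so are its
angular components. -/
theorem angularComponent_eq (hu : IsClampedSolution κ lam u) {k : ℕ} {g g' : ℝ → ℝ}
    (hg : IsAngularMode k g g') (hκ : κ = α * β) (hlam : lam = α ^ 2 - β ^ 2) (hα : 0 < α)
    (hJ : ∀ y y' y'' : ℝ → ℝ, IsRadialSolution k (-α ^ 2) y y' y'' →
      ∃ c, ∀ r ∈ Set.Ioo (0 : ℝ) 1, y r = c * radialSolution k (-α ^ 2) r) :
    ∃ c d, ∀ r ∈ Set.Ioo (0 : ℝ) 1, angularComponent g u r =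
      c * radialSolution k (-α ^ 2) r + d * radialSolution k (β ^ 2) r := by
  -- Here `v = (Δ - β²)u` satisfies `Δv = -α²v`, `w = (Δ + α²)u` satisfies `Δw = β²w`, and `w - v =
  -- (α² + β²)u`. Uniqueness for `-α²` enters as `hJ` because its proof differs between `k = 0` and
  -- `k ≥ 1`.
  have hv := hu.contDiffOn_laplacian_add_smul (-β ^ 2)
  have hw := hu.contDiffOn_laplacian_add_smul (α ^ 2)
  obtain ⟨c, hc⟩ := hJ _ _ _ (isRadialSolution_angularComponent hg hv (μ := -α ^ 2) fun x hx => by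
    rw [hu.laplacian_add_smul _ hx, hκ, hlam, Pi.add_apply, Pi.smul_apply, smul_eq_mul]
    ring)
  obtain ⟨d, hd⟩ := (isRadialSolution_angularComponent hg hw (μ := β ^ 2) fun x hx => by
    rw [hu.laplacian_add_smul _ hx, hκ, hlam, Pi.add_apply, Pi.smul_apply, smul_eq_mul]
    ring).eq_const_mul fun r hr => besselSeries_pos k (by positivity)
  have hs : 0 < α ^ 2 + β ^ 2 := by positivity
  refine ⟨-c / (α ^ 2 + β ^ 2), d / (α ^ 2 + β ^ 2), fun r hr => ?_⟩
  have hr' := Set.Ioo_zero_one_subset hr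
  have hint : ∀ f : Plane → ℝ, ContinuousOn f (ball 0 1) →
      IntervalIntegrable (fun θ => g θ * f (r • radialUnit θ)) MeasureTheory.volume 0
        (2 * Real.pi) := fun f hf =>
    (hg.continuous.mul (hf.comp_continuous (continuous_radialUnit.const_smul r)
      (smul_radialUnit_mem_ball hr'))).intervalIntegrable _ _
  have hsub : angularComponent g (Δ u + (α ^ 2) • u) r - angularComponent g (Δ u + (-β ^ 2) • u) r =
      (α ^ 2 + β ^ 2) * angularComponent g u r := by
    rw [angularComponent, angularComponent, angularComponent,
      ← intervalIntegral.integral_sub (hint _ hw.continuousOn) (hint _ hv.continuousOn),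
      ← intervalIntegral.integral_const_mul]
    refine intervalIntegral.integral_congr fun θ _ => ?_
    simp only [Pi.add_apply, Pi.smul_apply, smul_eq_mul]
    ring
  rw [hc r hr, hd r hr] at hsub
  field_simp
  linarith

/-- The boundary conditions, for an angular component. -/
theorem boundary_eq (hu : IsClampedSolution κ lam u) {g : ℝ → ℝ} (hg : Continuous g)
    {k : ℕ} {μ ν c d : ℝ}
    (h : ∀ r ∈ Set.Ioo (0 : ℝ) 1, angularComponent g u r =
      c * radialSolution k μ r + d * radialSolution k ν r) :
    Set.EqOn (angularComponent g u)
      (fun r => c * radialSolution k μ r + d * radialSolution k ν r) (Set.Icc 0 1) ∧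
    c * radialSolution k μ 1 + d * radialSolution k ν 1 = 0 ∧
      c * radialSolutionEuler k μ 1 + d * radialSolutionEuler k ν 1 = 0 := by
  have hgc : Continuous fun p : ℝ × ℝ => g p.2 := hg.comp continuous_snd
  have hrc : Continuous fun p : ℝ × ℝ => radialUnit p.2 := continuous_radialUnit.comp continuous_snd
  have h1 : (1 : ℝ) ∈ Set.Icc (0 : ℝ) 1 := by norm_num
  have c0 : ContinuousOn (angularComponent g u) (Set.Icc 0 1) :=
    continuousOn_intervalIntegral_Icc (F := fun r θ => g θ * u (r • radialUnit θ))
      (hgc.continuousOn.mul hu.contDiffOn_closedBall.continuousOn.comp_polar_closed) _ _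
  have c1 : ContinuousOn (fun r : ℝ => ∫ θ in (0 : ℝ)..(2 * Real.pi),
      g θ * fderivWithin ℝ u (closedBall 0 1) (r • radialUnit θ) (radialUnit θ)) (Set.Icc 0 1) :=
    continuousOn_intervalIntegral_Icc
      (F := fun r θ => g θ * fderivWithin ℝ u (closedBall 0 1) (r • radialUnit θ) (radialUnit θ))
      (hgc.continuousOn.mul ((hu.contDiffOn_closedBall.continuousOn_fderivWithin
        uniqueDiffOn_closedBall le_rfl).comp_polar_closed.clm_apply hrc.continuousOn)) _ _
  have e0 : Set.EqOn (angularComponent g u)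
      (fun r => c * radialSolution k μ r + d * radialSolution k ν r) (Set.Icc 0 1) :=
    Set.EqOn.Icc_of_Ioo c0 (((continuous_radialSolution k μ).const_mul c).add
      ((continuous_radialSolution k ν).const_mul d)).continuousOn h
  -- Derivatives are compared inside the disc and carried to `r = 1` by continuity of
  -- `fderivWithin`. The factor `r` makes the right-hand side continuous at `0` as well.
  have e1 := Set.EqOn.Icc_of_Ioo (continuousOn_id.mul c1)
    (((continuous_radialSolutionEuler k μ).const_mul c).add
      ((continuous_radialSolutionEuler k ν).const_mul d)).continuousOn fun r hr => by
    have hr' := Set.Ioo_zero_one_subset hr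
    have hd1 := hasDerivAt_angularComponent hg (hu.contDiffOn_ball.of_le (by norm_num)) hr'
    have hd2 := ((hasDerivAt_radialSolution k μ hr.1.ne').const_mul c).add
      ((hasDerivAt_radialSolution k ν hr.1.ne').const_mul d)
    have heq : angularComponent g u =ᶠ[𝓝 r]
        fun r => c * radialSolution k μ r + d * radialSolution k ν r := by
      filter_upwards [isOpen_Ioo.mem_nhds hr] with s hs using h s hs
    have hval := hd1.unique (hd2.congr_of_eventuallyEq heq)
    have hw : (∫ θ in (0 : ℝ)..(2 * Real.pi),
        g θ * fderivWithin ℝ u (closedBall 0 1) (r • radialUnit θ) (radialUnit θ)) =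
        angularComponentDeriv g u r := by
      refine intervalIntegral.integral_congr fun θ _ => ?_
      simp only [fderivWithin_closedBall u (smul_radialUnit_mem_ball hr' θ)]
    simp only [Pi.mul_apply, Pi.add_apply, id, hw, hval]
    have := hr.1.ne'
    field_simp
  refine ⟨e0, ?_, ?_⟩
  · have := e0 h1
    simp only at this
    rw [← this, angularComponent]
    simp only [one_smul, hu.boundary_value _ (radialUnit_mem_sphere _), mul_zero,
      intervalIntegral.integral_zero]
  · have := e1 h1
    simp only [Pi.mul_apply, one_smul, hu.boundary_deriv _ (radialUnit_mem_sphere _), mul_zero,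
      intervalIntegral.integral_zero] at this
    exact this.symm

theorem angularComponent_eq_zero (hu : IsClampedSolution κ lam u) {k : ℕ} (hk : 1 ≤ k)
    {g g' : ℝ → ℝ} (hg : IsAngularMode k g g') (hκ : κ = α * β) (hlam : lam = α ^ 2 - β ^ 2)
    (hα : 0 < α) (hαj : α < jOneOne) (hβ : 0 < β) {r : ℝ} (hr : r ∈ Set.Ioo (0 : ℝ) 1) :
    angularComponent g u r = 0 := by
  have hpos : ∀ m, 1 ≤ m → ∀ r, 0 < r → r ≤ 1 → 0 < besselSeries m (-α ^ 2 * r ^ 2 / 4) := by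
    intro m hm r hr0 hr1
    have e : -α ^ 2 * r ^ 2 / 4 = -((α * r / 2) ^ 2) := by ring
    rw [e]
    refine besselSeries_neg_pos hm (by positivity) ?_
    gcongr
    calc α * r ≤ α := mul_le_of_le_one_right hα.le hr1
      _ < jOneOne := hαj
  obtain ⟨c, d, hcd⟩ := hu.angularComponent_eq hg hκ hlam hα fun y y' y'' h =>
    h.eq_const_mul fun r hr => hpos k hk r hr.1 hr.2.le
  obtain ⟨-, h0, h1⟩ := hu.boundary_eq hg.continuous hcd
  have a0 := hpos k hk 1 one_pos le_rfl
  have a1 := hpos (k + 1) (by lia) 1 one_pos le_rfl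
  have b0 : 0 < besselSeries k (β ^ 2 * 1 ^ 2 / 4) := besselSeries_pos k (by positivity)
  have b1 : 0 < besselSeries (k + 1) (β ^ 2 * 1 ^ 2 / 4) := besselSeries_pos (k + 1) (by positivity)
  simp only [radialSolutionEuler, radialSolution, one_pow, one_mul, mul_one] at h0 h1 a0 a1 b0 b1
  set A := besselSeries k (-α ^ 2 / 4)
  set A' := besselSeries (k + 1) (-α ^ 2 / 4)
  set B := besselSeries k (β ^ 2 / 4)
  set B' := besselSeries (k + 1) (β ^ 2 / 4)
  -- Eliminating `d` leaves the determinant of the boundary system; the terms in `k` cancel and the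
  -- remaining ones are positive.
  have hc : c * (α ^ 2 * A' * B + β ^ 2 * B' * A) = 0 := by
    linear_combination (2 * k * B + β ^ 2 * B') * h0 - 2 * B * h1
  have hc0 : c = 0 := (mul_eq_zero.1 hc).resolve_right (by positivity)
  have hd0 : d = 0 := by
    rw [hc0, zero_mul, zero_add] at h0
    exact (mul_eq_zero.1 h0).resolve_right b0.ne'
  rw [hcd r hr, hc0, hd0]
  ring

end IsClampedSolution

/-! ### The radial mode -/

theorem radialSolution_zero_neg_sq (α r : ℝ) : radialSolution 0 (-α ^ 2) r = besselJ 0 (α * r) := by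
  rw [radialSolution, besselJ_zero_eq, pow_zero, one_mul]
  congr 1
  ring

theorem radialSolution_zero_sq (β r : ℝ) : radialSolution 0 (β ^ 2) r = besselI 0 (β * r) := by
  rw [radialSolution, besselI_zero_eq, pow_zero, one_mul]
  congr 1
  ring

theorem radialSolutionEuler_zero_neg_sq_one (α : ℝ) :
    radialSolutionEuler 0 (-α ^ 2) 1 = α * deriv (besselJ 0) α := by
  rw [radialSolutionEuler, (hasDerivAt_besselJ_zero α).deriv, besselJ_eq]
  simp only [CharP.cast_eq_zero, zero_mul, zero_add, one_pow, one_mul, mul_one]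
  rw [show -α ^ 2 / 4 = -(α / 2) ^ 2 by ring]
  ring

theorem radialSolutionEuler_zero_sq_one (β : ℝ) :
    radialSolutionEuler 0 (β ^ 2) 1 = β * deriv (besselI 0) β := by
  rw [radialSolutionEuler, (hasDerivAt_besselI_zero β).deriv, besselI_eq]
  simp only [CharP.cast_eq_zero, zero_mul, zero_add, one_pow, one_mul, mul_one]
  rw [show β ^ 2 / 4 = (β / 2) ^ 2 by ring]
  ring

theorem IsClampedSolution.exists_eq {κ lam α β : ℝ} {u : Plane → ℝ}
    (hu : IsClampedSolution κ lam u) (hκ : κ = α * β) (hlam : lam = α ^ 2 - β ^ 2)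
    (hα : 0 < α) (hαj : α < jOneOne) (hβ : 0 < β) :
    ∃ c d : ℝ, c * besselJ 0 α + d * besselI 0 β = 0 ∧
      c * (α * deriv (besselJ 0) α) + d * (β * deriv (besselI 0) β) = 0 ∧
      ∀ x ∈ closedBall (0 : Plane) 1,
        u x = c * besselJ 0 (α * ‖x‖) + d * besselI 0 (β * ‖x‖) := by
  have hg : IsAngularMode 0 (fun _ => 1) (fun _ => 0) :=
    ⟨fun θ => hasDerivAt_const θ 1, fun θ => by simpa using hasDerivAt_const θ (0 : ℝ), rfl, rfl⟩
  obtain ⟨c, d, hcd⟩ := hu.angularComponent_eq hg hκ hlam hα fun y y' y'' h =>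
    h.eq_const_mul_of_neg (by nlinarith)
  obtain ⟨-, h0, h1⟩ := hu.boundary_eq hg.continuous hcd
  rw [radialSolution_zero_neg_sq, radialSolution_zero_sq, mul_one, mul_one] at h0
  rw [radialSolutionEuler_zero_neg_sq_one, radialSolutionEuler_zero_sq_one] at h1
  have hpi := Real.pi_pos
  refine ⟨1 / (2 * Real.pi) * c, 1 / (2 * Real.pi) * d, by linear_combination 1 / (2 * Real.pi) * h0,
    by linear_combination 1 / (2 * Real.pi) * h1, fun x hx => ?_⟩
  -- On each circle inside the disc all modes `k ≥ 1` vanish, so `u` equals its mean, the mode `k =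
  -- 0` divided by `2π`. Continuity along the ray reaches the centre and the boundary.
  obtain ⟨θ, hθ⟩ := exists_eq_smul_radialUnit x
  have hray : Set.EqOn (fun r => u (r • radialUnit θ)) (fun r => 1 / (2 * Real.pi) * c *
      besselJ 0 (α * r) + 1 / (2 * Real.pi) * d * besselI 0 (β * r)) (Set.Icc 0 1) := by
    refine Set.EqOn.Icc_of_Ioo ?_ ?_ fun r hr => ?_
    · exact hu.contDiffOn_closedBall.continuousOn.comp (by fun_prop)
        fun r hr => smul_radialUnit_mem_closedBall hr θ
    · exact (((continuous_besselJ 0).comp (by fun_prop)).const_mul _ |>.add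
        (((continuous_besselI 0).comp (by fun_prop)).const_mul _)).continuousOn
    · have hr' := Set.Ioo_zero_one_subset hr
      have := eq_average_of_fourier_modes_eq_zero (f := fun θ => u (r • radialUnit θ))
        (hu.contDiffOn_ball.continuousOn.comp_continuous (continuous_radialUnit.const_smul r)
          (smul_radialUnit_mem_ball hr')) (fun θ => by simp only [radialUnit_add_two_pi])
        (fun k hk => hu.angularComponent_eq_zero hk (isAngularMode_cos k) hκ hlam hα hαj hβ hr)
        (fun k hk => hu.angularComponent_eq_zero hk (isAngularMode_sin k) hκ hlam hα hαj hβ hr) θ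
      have h2 := hcd r hr
      simp only [angularComponent, one_mul] at h2
      rw [this, h2, radialSolution_zero_neg_sq, radialSolution_zero_sq]
      ring
  have hx1 : ‖x‖ ∈ Set.Icc (0 : ℝ) 1 := ⟨norm_nonneg x, mem_closedBall_zero_iff.1 hx⟩
  have := hray hx1
  simp only at this
  rwa [← hθ] at this

/-! ### Radial solutions of the Helmholtz equation in the plane -/

/-- The radial solution of `Δ h = μ h` with `h 0 = 1`. -/
noncomputable def helmholtzRadial (μ : ℝ) (x : Plane) : ℝ := besselSeries 0 (μ * ‖x‖ ^ 2 / 4)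

/-- The series depends on `‖x‖²`, which is smooth at the origin although `‖x‖` is not. -/
theorem contDiff_helmholtzRadial (μ : ℝ) (n : ℕ) : ContDiff ℝ n (helmholtzRadial μ) :=
  (contDiff_besselSeries n 0).comp ((contDiff_const.mul (contDiff_norm_sq ℝ)).div_const 4)

theorem hasFDerivAt_besselSeries_norm_sq (k : ℕ) (μ : ℝ) (x : Plane) :
    HasFDerivAt (fun x : Plane => besselSeries k (μ * ‖x‖ ^ 2 / 4))
      ((μ / 2 * besselSeries (k + 1) (μ * ‖x‖ ^ 2 / 4)) • innerSL ℝ x) x := by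
  have h1 : HasFDerivAt (fun x : Plane => ‖x‖ ^ 2) (2 • innerSL ℝ x) x :=
    (hasStrictFDerivAt_norm_sq x).hasFDerivAt
  have h2 : HasDerivAt (fun s : ℝ => besselSeries k (μ * s / 4))
      (besselSeries (k + 1) (μ * ‖x‖ ^ 2 / 4) * (μ / 4)) (‖x‖ ^ 2) := by
    have h : HasDerivAt (fun s : ℝ => μ * s / 4) (μ / 4) (‖x‖ ^ 2) := by
      simpa using ((hasDerivAt_id' (‖x‖ ^ 2)).const_mul μ).div_const 4
    exact (hasDerivAt_besselSeries k (μ * ‖x‖ ^ 2 / 4)).comp (‖x‖ ^ 2) h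
  refine (h2.comp_hasFDerivAt x h1).congr_fderiv ?_
  ext y
  simp only [smul_apply, smul_eq_mul, nsmul_eq_mul]
  push_cast
  ring

theorem laplacian_helmholtzRadial (μ : ℝ) (x : Plane) :
    Δ (helmholtzRadial μ) x = μ * helmholtzRadial μ x := by
  have h1 : fderiv ℝ (helmholtzRadial μ) = fun x =>
      (μ / 2 * besselSeries 1 (μ * ‖x‖ ^ 2 / 4)) • innerSL ℝ x :=
    funext fun x => (hasFDerivAt_besselSeries_norm_sq 0 μ x).fderiv
  have h2 := ((hasFDerivAt_besselSeries_norm_sq 1 μ x).const_mul (μ / 2)).smul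
    (innerSL ℝ (E := Plane)).hasFDerivAt
  have h3 : ∀ y, fderiv ℝ (fderiv ℝ (helmholtzRadial μ)) x y y =
      μ ^ 2 / 4 * besselSeries 2 (μ * ‖x‖ ^ 2 / 4) * (inner ℝ x y) ^ 2 +
        μ / 2 * besselSeries 1 (μ * ‖x‖ ^ 2 / 4) * ‖y‖ ^ 2 := by
    intro y
    have h4 : fderiv ℝ (fun x : Plane => (μ / 2 * besselSeries 1 (μ * ‖x‖ ^ 2 / 4)) • innerSL ℝ x)
        x = _ := HasFDerivAt.fderiv h2
    rw [h1, h4, ← real_inner_self_eq_norm_sq y]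
    simp only [add_apply, smul_apply, ContinuousLinearMap.smulRight_apply, smul_eq_mul]
    change _ = _ * (innerSL ℝ x y) ^ 2 + _ * innerSL ℝ y y
    ring
  have hn : ‖x‖ ^ 2 = x 0 ^ 2 + x 1 ^ 2 := by
    rw [EuclideanSpace.norm_sq_eq, Fin.sum_univ_two]
    simp
  have ht : ‖tangentialUnit 0‖ = 1 := by
    simp [tangentialUnit, EuclideanSpace.norm_eq, Fin.sum_univ_two]
  have i1 : inner ℝ x (radialUnit 0) = x 0 := by simp [radialUnit, PiLp.inner_apply]
  have i2 : inner ℝ x (tangentialUnit 0) = x 1 := by simp [tangentialUnit, PiLp.inner_apply]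
  rw [laplacian_eq_fderiv_fderiv _ x 0, h3, h3, i1, i2, norm_radialUnit, ht, helmholtzRadial,
    ← besselSeries_recurrence 0]
  rw [hn]
  push_cast
  ring

theorem helmholtzRadial_neg_sq (α : ℝ) (x : Plane) :
    helmholtzRadial (-α ^ 2) x = besselJ 0 (α * ‖x‖) := by
  rw [helmholtzRadial, besselJ_zero_eq]
  congr 1
  ring

theorem helmholtzRadial_sq (β : ℝ) (x : Plane) :
    helmholtzRadial (β ^ 2) x = besselI 0 (β * ‖x‖) := by
  rw [helmholtzRadial, besselI_zero_eq]
  congr 1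
  ring

theorem helmholtzRadial_zero (μ : ℝ) : helmholtzRadial μ 0 = 1 := by
  simp [helmholtzRadial, besselSeries_zero_arg]

theorem fderiv_helmholtzRadial_self (μ : ℝ) {x : Plane} (hx : ‖x‖ = 1) :
    fderiv ℝ (helmholtzRadial μ) x x = radialSolutionEuler 0 μ 1 := by
  have h : fderiv ℝ (helmholtzRadial μ) x = _ := (hasFDerivAt_besselSeries_norm_sq 0 μ x).fderiv
  rw [h]
  simp [radialSolutionEuler, hx]

section

variable {𝕜 : Type*} [RCLike 𝕜]

/-- The combination of two radial Helmholtz solutions with coefficients `c` and `d`. -/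
noncomputable def radialCombination (μ ν : ℝ) (c d : 𝕜) (x : Plane) : 𝕜 :=
  helmholtzRadial μ x • c + helmholtzRadial ν x • d

theorem contDiff_radialCombination (μ ν : ℝ) (c d : 𝕜) (n : ℕ) :
    ContDiff ℝ n (radialCombination μ ν c d) :=
  ((contDiff_helmholtzRadial μ n).smul contDiff_const).add
    ((contDiff_helmholtzRadial ν n).smul contDiff_const)

theorem laplacian_helmholtzRadial_smul (μ : ℝ) (c : 𝕜) (x : Plane) :
    Δ (fun x => helmholtzRadial μ x • c) x = helmholtzRadial μ x • (μ • c) := by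
  have h := (contDiff_helmholtzRadial μ 2).contDiffAt (x := x)
  have := h.laplacian_CLM_comp_left (l := ContinuousLinearMap.toSpanSingleton ℝ c)
  rw [Function.comp_def] at this
  simp only [ContinuousLinearMap.toSpanSingleton_apply, Function.comp,
    laplacian_helmholtzRadial] at this
  rw [this, smul_smul, mul_comm]

theorem laplacian_radialCombination (μ ν : ℝ) (c d : 𝕜) :
    Δ (radialCombination μ ν c d) = radialCombination μ ν (μ • c) (ν • d) := by
  funext x
  have h1 : ContDiffAt ℝ 2 (fun x => helmholtzRadial μ x • c) x :=
    ((contDiff_helmholtzRadial μ 2).smul contDiff_const).contDiffAt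
  have h2 : ContDiffAt ℝ 2 (fun x => helmholtzRadial ν x • d) x :=
    ((contDiff_helmholtzRadial ν 2).smul contDiff_const).contDiffAt
  have h := h1.laplacian_add h2
  rw [laplacian_helmholtzRadial_smul, laplacian_helmholtzRadial_smul] at h
  exact h

theorem fderiv_radialCombination_self (μ ν : ℝ) (c d : 𝕜) {x : Plane} (hx : ‖x‖ = 1) :
    fderiv ℝ (radialCombination μ ν c d) x x =
      radialSolutionEuler 0 μ 1 • c + radialSolutionEuler 0 ν 1 • d := by
  have h : ∀ μ, DifferentiableAt ℝ (helmholtzRadial μ) x := fun μ =>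
    (contDiff_helmholtzRadial μ 1).contDiffAt.differentiableAt (by norm_num)
  have h1 := ((h μ).hasFDerivAt.smul_const c).add ((h ν).hasFDerivAt.smul_const d)
  have h2 : fderiv ℝ (radialCombination μ ν c d) x = _ := HasFDerivAt.fderiv h1
  rw [h2]
  simp only [add_apply, ContinuousLinearMap.smulRight_apply, fderiv_helmholtzRadial_self _ hx]

/-! ### Eigenfunctions -/

/-- Real-linear functionals commute with `Δ`; taking real and imaginary parts reduces the problem to
real-valued solutions, possibly zero. -/
theorem IsBucklingEigenfunction.clm_comp {κ lam : ℝ} {u : Plane → 𝕜}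
    (hu : IsBucklingEigenfunction κ lam u) (L : 𝕜 →L[ℝ] ℝ) :
    IsClampedSolution κ lam (L ∘ u) where
  contDiffOn_ball := L.contDiff.comp_contDiffOn hu.contDiffOn_ball
  contDiffOn_closedBall := L.contDiff.comp_contDiffOn hu.contDiffOn_closedBall
  equation x hx := by
    have h1 : ∀ y ∈ ball (0 : Plane) 1, Δ (L ∘ u) y = (L ∘ Δ u) y := fun y hy =>
      ((hu.contDiffOn_ball.contDiffAt (isOpen_ball.mem_nhds hy)).of_le
        (by norm_num)).laplacian_CLM_comp_left
    have h2 : Δ (L ∘ u) =ᶠ[𝓝 x] L ∘ Δ u := by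
      filter_upwards [isOpen_ball.mem_nhds hx] with y hy using h1 y hy
    have h3 : Δ (L ∘ Δ u) x = (L ∘ Δ (Δ u)) x :=
      (hu.contDiffOn_ball.laplacian_ball.contDiffAt
        (isOpen_ball.mem_nhds hx)).laplacian_CLM_comp_left
    rw [(InnerProductSpace.laplacian_congr_nhds h2).eq_of_nhds, h3, h1 x hx]
    have h4 := congrArg L (hu.equation x hx)
    rw [map_sub, map_neg, L.map_smul, L.map_smul, smul_eq_mul, smul_eq_mul] at h4
    exact h4
  boundary_value x hx := by simp [hu.boundary_value x hx]
  boundary_deriv x hx := by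
    have hx' := sphere_subset_closedBall hx
    have h := ((hu.contDiffOn_closedBall x hx').differentiableWithinAt (by norm_num)).hasFDerivWithinAt
    have h2 := (L.hasFDerivAt.comp_hasFDerivWithinAt x h).fderivWithin (uniqueDiffOn_closedBall x hx')
    rw [h2]
    simp [hu.boundary_deriv x hx]

theorem IsBucklingEigenfunction.exists_isBoundaryCoeff {κ lam α : ℝ} {u : Plane → 𝕜}
    (hu : IsBucklingEigenfunction κ lam u) (hκ : 0 < κ) (hα : 0 < α) (hαj : α < jOneOne)
    (hlam : lam = α ^ 2 - κ ^ 2 / α ^ 2) :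
    ∃ c d : 𝕜, IsBoundaryCoeff κ α c d ∧ ∀ x ∈ closedBall (0 : Plane) 1,
      u x = c * ((besselJ 0 (α * ‖x‖) : ℝ) : 𝕜) + d * ((besselI 0 (κ / α * ‖x‖) : ℝ) : 𝕜) := by
  have hκ' : κ = α * (κ / α) := by field_simp
  have hlam' : lam = α ^ 2 - (κ / α) ^ 2 := by rw [hlam, div_pow]
  have hβ : 0 < κ / α := div_pos hκ hα
  obtain ⟨c₁, d₁, e₁, f₁, h₁⟩ := (hu.clm_comp RCLike.reCLM).exists_eq hκ' hlam' hα hαj hβ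
  obtain ⟨c₂, d₂, e₂, f₂, h₂⟩ := (hu.clm_comp RCLike.imCLM).exists_eq hκ' hlam' hα hαj hβ
  have hform : ∀ x ∈ closedBall (0 : Plane) 1, u x =
      ((c₁ : 𝕜) + c₂ * RCLike.I) * ((besselJ 0 (α * ‖x‖) : ℝ) : 𝕜) +
        ((d₁ : 𝕜) + d₂ * RCLike.I) * ((besselI 0 (κ / α * ‖x‖) : ℝ) : 𝕜) := by
    intro x hx
    have h₁ : RCLike.re (u x) = _ := h₁ x hx
    have h₂ : RCLike.im (u x) = _ := h₂ x hx
    rw [← RCLike.re_add_im (u x), h₁, h₂]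
    push_cast
    ring
  refine ⟨_, _, ⟨fun h0 => ?_, ?_, ?_⟩, hform⟩
  · obtain ⟨x, hx, hne⟩ := hu.nontrivial
    rw [Prod.mk_eq_zero] at h0
    refine hne ?_
    rw [hform x (ball_subset_closedBall hx), h0.1, h0.2]
    simp
  · have e₁' := congrArg (fun t : ℝ => (t : 𝕜)) e₁
    have e₂' := congrArg (fun t : ℝ => (t : 𝕜)) e₂
    push_cast at e₁' e₂'
    linear_combination e₁' + RCLike.I * e₂'
  · have f₁' := congrArg (fun t : ℝ => (t : 𝕜)) f₁
    have f₂' := congrArg (fun t : ℝ => (t : 𝕜)) f₂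
    push_cast at f₁' f₂' ⊢
    linear_combination f₁' + RCLike.I * f₂'

/-- Cramer's rule: `F_0(α)` is the determinant of the system, up to sign. -/
theorem IsBoundaryCoeff.bucklingDet_eq_zero {κ α : ℝ} {c d : 𝕜} (h : IsBoundaryCoeff κ α c d) :
    bucklingDet 0 κ α = 0 := by
  obtain ⟨hne, h1, h2⟩ := h
  by_contra hdet
  have hdet' : ((bucklingDet 0 κ α : ℝ) : 𝕜) ≠ 0 := by exact_mod_cast hdet
  refine hne (Prod.mk_eq_zero.2 ⟨?_, ?_⟩)
  · refine (mul_eq_zero.1 (?_ : c * ((bucklingDet 0 κ α : ℝ) : 𝕜) = 0)).resolve_right hdet'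
    rw [bucklingDet]
    push_cast at h1 h2 ⊢
    linear_combination ((κ : 𝕜) / α * (deriv (besselI 0) (κ / α) : ℝ)) * h1 -
      ((besselI 0 (κ / α) : ℝ) : 𝕜) * h2
  · refine (mul_eq_zero.1 (?_ : d * ((bucklingDet 0 κ α : ℝ) : 𝕜) = 0)).resolve_right hdet'
    rw [bucklingDet]
    push_cast at h1 h2 ⊢
    linear_combination ((besselJ 0 α : ℝ) : 𝕜) * h2 -
      ((α : 𝕜) * (deriv (besselJ 0) α : ℝ)) * h1

theorem IsBoundaryCoeff.isBucklingEigenfunction {κ α : ℝ} {c d : 𝕜} (h : IsBoundaryCoeff κ α c d)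
    (hα : 0 < α) {u : Plane → 𝕜}
    (hu : ∀ x ∈ closedBall (0 : Plane) 1,
      u x = c * ((besselJ 0 (α * ‖x‖) : ℝ) : 𝕜) + d * ((besselI 0 (κ / α * ‖x‖) : ℝ) : 𝕜)) :
    IsBucklingEigenfunction κ (α ^ 2 - κ ^ 2 / α ^ 2) u := by
  obtain ⟨hne, h1, h2⟩ := h
  set β := κ / α with hβ
  have hκ : κ = α * β := by rw [hβ]; field_simp
  have hlam : α ^ 2 - κ ^ 2 / α ^ 2 = α ^ 2 - β ^ 2 := by rw [hβ, div_pow]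
  set U : Plane → 𝕜 := radialCombination (-α ^ 2) (β ^ 2) c d with hU
  have huU : Set.EqOn u U (closedBall 0 1) := by
    intro x hx
    rw [hu x hx, hU, radialCombination, helmholtzRadial_neg_sq, helmholtzRadial_sq,
      RCLike.real_smul_eq_coe_mul, RCLike.real_smul_eq_coe_mul, mul_comm c, mul_comm d]
  have huU' : ∀ x ∈ ball (0 : Plane) 1, u =ᶠ[𝓝 x] U := fun x hx => by
    filter_upwards [isOpen_ball.mem_nhds hx] with y hy using huU (ball_subset_closedBall hy)
  have hΔ : ∀ x ∈ ball (0 : Plane) 1, Δ u x =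
      radialCombination (-α ^ 2) (β ^ 2) ((-α ^ 2) • c) ((β ^ 2) • d) x := fun x hx => by
    rw [(InnerProductSpace.laplacian_congr_nhds (huU' x hx)).eq_of_nhds, hU,
      laplacian_radialCombination]
  refine ⟨?_, ?_, fun x hx => ?_, fun x hx => ?_, fun x hx => ?_, ?_⟩
  · exact (contDiff_radialCombination _ _ c d 4).contDiffOn.congr
      fun x hx => huU (ball_subset_closedBall hx)
  · exact (contDiff_radialCombination _ _ c d 1).contDiffOn.congr fun x hx => huU hx
  · have hΔΔ : Δ (Δ u) x = radialCombination (-α ^ 2) (β ^ 2) ((-α ^ 2) • (-α ^ 2) • c)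
        ((β ^ 2) • (β ^ 2) • d) x := by
      rw [← laplacian_radialCombination]
      refine (InnerProductSpace.laplacian_congr_nhds ?_).eq_of_nhds
      filter_upwards [isOpen_ball.mem_nhds hx] with y hy using hΔ y hy
    rw [hΔΔ, hΔ x hx, huU (ball_subset_closedBall hx), hlam, hκ]
    simp only [hU, radialCombination]
    module
  · rw [huU (sphere_subset_closedBall hx)]
    rw [mem_sphere_zero_iff_norm] at hx
    rw [hU, radialCombination, helmholtzRadial_neg_sq, helmholtzRadial_sq, hx, mul_one, mul_one,
      RCLike.real_smul_eq_coe_mul, RCLike.real_smul_eq_coe_mul, mul_comm _ c, mul_comm _ d, h1]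
  · have hx' := sphere_subset_closedBall hx
    rw [fderivWithin_congr huU (huU hx'), (((contDiff_radialCombination (-α ^ 2) (β ^ 2) c d
      1).contDiffAt).differentiableAt (by norm_num)).fderivWithin (uniqueDiffOn_closedBall x hx'),
      fderiv_radialCombination_self _ _ _ _ (mem_sphere_zero_iff_norm.1 hx),
      radialSolutionEuler_zero_neg_sq_one, radialSolutionEuler_zero_sq_one,
      RCLike.real_smul_eq_coe_mul, RCLike.real_smul_eq_coe_mul, mul_comm _ c, mul_comm _ d, h2]
  -- If `u` vanished on the disc, the values of `u` and `Δu` at the centre would give `c + d = 0`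
  -- and `-α²c + β²d = 0`, a system with determinant `α² + β² > 0`.
  · by_contra hcon
    push Not at hcon
    have h0 : (0 : Plane) ∈ ball (0 : Plane) 1 := mem_ball_self one_pos
    have hu0 : u =ᶠ[𝓝 0] fun _ => (0 : 𝕜) := by
      filter_upwards [isOpen_ball.mem_nhds h0] with y hy using hcon y hy
    have e1 : c + d = 0 := by
      have := huU (ball_subset_closedBall h0)
      rw [hcon 0 h0, hU, radialCombination, helmholtzRadial_zero, helmholtzRadial_zero, one_smul,
        one_smul] at this
      exact this.symm
    have e2 : (-α ^ 2) • c + (β ^ 2) • d = 0 := by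
      have := hΔ 0 h0
      rw [(InnerProductSpace.laplacian_congr_nhds hu0).eq_of_nhds,
        InnerProductSpace.laplacian_const, radialCombination, helmholtzRadial_zero,
        helmholtzRadial_zero, one_smul, one_smul] at this
      exact this.symm
    have e3 : (α ^ 2 + β ^ 2) • c = 0 := by
      rw [eq_neg_of_add_eq_zero_right e1] at e2
      rw [← neg_eq_zero, ← e2]
      module
    have hc : c = 0 := (smul_eq_zero.1 e3).resolve_left (by positivity)
    rw [hc, zero_add] at e1
    exact hne (Prod.mk_eq_zero.2 ⟨hc, e1⟩)

/-! ### The first eigenvalue -/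

theorem exists_pos_sq_sub_sq_div_eq (κ lam : ℝ) (hκ : 0 < κ) :
    ∃ α, 0 < α ∧ lam = α ^ 2 - κ ^ 2 / α ^ 2 := by
  set s := √(lam ^ 2 + 4 * κ ^ 2) with hs
  have hs2 : s ^ 2 = lam ^ 2 + 4 * κ ^ 2 := Real.sq_sqrt (by positivity)
  have hlt : |lam| < s :=
    abs_lt_of_sq_lt_sq (by nlinarith [pow_pos hκ 2]) (Real.sqrt_nonneg _)
  -- The square of the desired `α` is the positive root of `t² - lam t - κ² = 0`.
  set t := (lam + s) / 2 with ht
  have htpos : 0 < t := by linarith [(abs_lt.1 hlt).1]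
  have ht2 : t ^ 2 - lam * t = κ ^ 2 := by
    rw [ht]
    linear_combination hs2 / 4
  refine ⟨√t, Real.sqrt_pos.2 htpos, ?_⟩
  rw [Real.sq_sqrt htpos.le, ← ht2]
  field_simp
  ring

theorem isBoundaryCoeff_alphaZeroOne {κ : ℝ} (hκ : 0 < κ) :
    IsBoundaryCoeff κ (alphaZeroOne κ) ((besselI 0 (κ / alphaZeroOne κ) : ℝ) : 𝕜)
      (-((besselJ 0 (alphaZeroOne κ) : ℝ) : 𝕜)) := by
  refine ⟨fun h => ?_, by ring, ?_⟩
  · have h1 := (Prod.mk_eq_zero.1 h).1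
    exact (besselI_pos 0 (div_pos hκ (alphaZeroOne_pos hκ))).ne' (by exact_mod_cast h1)
  · have h := bucklingDet_zero_alphaZeroOne hκ
    rw [bucklingDet] at h
    have h' := congrArg (fun t : ℝ => (t : 𝕜)) h
    push_cast at h' ⊢
    linear_combination -h'

-- An eigenvalue with parameter `α < α_{0,1} < j_{1,1}` would have a radial eigenfunction, making
-- `α` a root of `F_0` below the first one. For larger `α` the monotonicity of `α² - κ²/α²`
-- concludes.
variable (𝕜) in
theorem isLeast_bucklingEigenvalues {κ : ℝ} (hκ : 0 < κ) :
    IsLeast (bucklingEigenvalues 𝕜 κ) (alphaZeroOne κ ^ 2 - κ ^ 2 / alphaZeroOne κ ^ 2) := by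
  refine ⟨⟨_, (isBoundaryCoeff_alphaZeroOne hκ).isBucklingEigenfunction (alphaZeroOne_pos hκ)
    fun x _ => rfl⟩, ?_⟩
  rintro lam ⟨u, hu⟩
  obtain ⟨α, hα, hlam⟩ := exists_pos_sq_sub_sq_div_eq κ lam hκ
  rcases le_or_gt (alphaZeroOne κ) α with hle | hlt
  · rcases hle.eq_or_lt with heq | hlt
    · rw [hlam, heq]
    · rw [hlam]
      exact (sq_sub_sq_div_lt hκ le_rfl (alphaZeroOne_pos hκ) hlt).le
  · obtain ⟨c, d, hcd, -⟩ := hu.exists_isBoundaryCoeff hκ hα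
      (hlt.trans (alphaZeroOne_lt_jOneOne hκ)) hlam
    exact absurd ((isLeast_alphaZeroOne hκ).2 ⟨hα, hcd.bucklingDet_eq_zero⟩) (not_le.2 hlt)

variable (𝕜) in
theorem firstBucklingEigenvalue_eq {κ : ℝ} (hκ : 0 < κ) :
    firstBucklingEigenvalue 𝕜 κ = alphaZeroOne κ ^ 2 - κ ^ 2 / alphaZeroOne κ ^ 2 :=
  (isLeast_bucklingEigenvalues 𝕜 hκ).csInf_eq

theorem isBucklingEigenfunction_first_iff {κ : ℝ} (hκ : 0 < κ) (u : Plane → 𝕜) :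
    IsBucklingEigenfunction κ (firstBucklingEigenvalue 𝕜 κ) u ↔
      ∃ c d : 𝕜, IsBoundaryCoeff κ (alphaZeroOne κ) c d ∧
        ∀ x ∈ closedBall (0 : Plane) 1,
          u x = c * ((besselJ 0 (alphaZeroOne κ * ‖x‖) : ℝ) : 𝕜)
            + d * ((besselI 0 (κ / alphaZeroOne κ * ‖x‖) : ℝ) : 𝕜) := by
  rw [firstBucklingEigenvalue_eq 𝕜 hκ]
  constructor
  · intro hu
    exact hu.exists_isBoundaryCoeff hκ (alphaZeroOne_pos hκ) (alphaZeroOne_lt_jOneOne hκ) rfl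
  · rintro ⟨c, d, hcd, hform⟩
    exact hcd.isBucklingEigenfunction (alphaZeroOne_pos hκ) hform

variable (𝕜) in
theorem isSimpleBucklingEigenvalue_first {κ : ℝ} (hκ : 0 < κ) :
    IsSimpleBucklingEigenvalue 𝕜 κ (firstBucklingEigenvalue 𝕜 κ) := by
  refine ⟨_, (isBucklingEigenfunction_first_iff hκ _).2
    ⟨_, _, isBoundaryCoeff_alphaZeroOne hκ, fun x _ => rfl⟩, fun u hu => ?_⟩
  obtain ⟨c, d, ⟨-, h1, -⟩, hform⟩ := (isBucklingEigenfunction_first_iff hκ u).1 hu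
  have hB : ((besselI 0 (κ / alphaZeroOne κ) : ℝ) : 𝕜) ≠ 0 := by
    exact_mod_cast (besselI_pos 0 (div_pos hκ (alphaZeroOne_pos hκ))).ne'
  -- As `I_0 ≠ 0`, the first boundary equation alone fixes `d` from `c`; the reference eigenfunction
  -- has first coefficient `I_0(κ/α)`, hence this ratio.
  refine ⟨c / ((besselI 0 (κ / alphaZeroOne κ) : ℝ) : 𝕜), fun x hx => ?_⟩
  rw [hform x hx]
  generalize ((besselI 0 (κ / alphaZeroOne κ * ‖x‖) : ℝ) : 𝕜) = P
  rw [div_mul_eq_mul_div, eq_div_iff hB]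
  linear_combination P * h1

end

theorem theorem3p7 (𝕜 : Type*) [RCLike 𝕜] :
    IsLeast (positiveZeros (besselJ 1)) jOneOne ∧
    (∀ κ : ℝ, 0 < κ →
      IsLeast (positiveZeros (bucklingDet 0 κ)) (alphaZeroOne κ) ∧
      IsLeast (bucklingEigenvalues 𝕜 κ) (firstBucklingEigenvalue 𝕜 κ) ∧
      firstBucklingEigenvalue 𝕜 κ = alphaZeroOne κ ^ 2 - κ ^ 2 / alphaZeroOne κ ^ 2 ∧
      IsSimpleBucklingEigenvalue 𝕜 κ (firstBucklingEigenvalue 𝕜 κ) ∧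
      ∀ u : Plane → 𝕜, IsBucklingEigenfunction κ (firstBucklingEigenvalue 𝕜 κ) u ↔
        ∃ c d : 𝕜, IsBoundaryCoeff κ (alphaZeroOne κ) c d ∧
          ∀ x ∈ closedBall (0 : Plane) 1,
            u x = c * ((besselJ 0 (alphaZeroOne κ * ‖x‖) : ℝ) : 𝕜)
              + d * ((besselI 0 (κ / alphaZeroOne κ * ‖x‖) : ℝ) : 𝕜)) ∧
    StrictAntiOn (firstBucklingEigenvalue 𝕜) (Set.Ioi 0) ∧
    Tendsto (firstBucklingEigenvalue 𝕜) (𝓝[>] 0) (𝓝 (jOneOne ^ 2)) ∧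
    Tendsto (firstBucklingEigenvalue 𝕜) atTop atBot := by
  have heq : Set.EqOn (fun κ => alphaZeroOne κ ^ 2 - κ ^ 2 / alphaZeroOne κ ^ 2)
      (firstBucklingEigenvalue 𝕜) (Set.Ioi 0) := fun κ hκ =>
    (firstBucklingEigenvalue_eq 𝕜 hκ).symm
  refine ⟨isLeast_jOneOne_and_pos.1, fun κ hκ => ⟨isLeast_alphaZeroOne hκ, ?_,
    firstBucklingEigenvalue_eq 𝕜 hκ, isSimpleBucklingEigenvalue_first 𝕜 hκ,
    isBucklingEigenfunction_first_iff hκ⟩, strictAntiOn_lambda.congr heq,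
    tendsto_lambda_zero.congr' (heq.eventuallyEq_of_mem self_mem_nhdsWithin),
    tendsto_lambda_atTop.congr' (heq.eventuallyEq_of_mem (Ioi_mem_atTop 0))⟩
  rw [firstBucklingEigenvalue_eq 𝕜 hκ]
  exact isLeast_bucklingEigenvalues 𝕜 hκ
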